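/- Let $Q$ be a finite quiver with vertex set $Q_0$; an arrow $a$ has tail $t(a)$ and head $h(a)$, paths are composed from right to left, and $e_v$ is the trivial path at $v$. Call $Q$ biserial if every vertex is the head of at most two arrows and the tail of at most two arrows. Let $Z$ be a set of paths of length at least $2$ such that $(Q,Z)$ is special: for every arrow $b$ there is at most one arrow $a$ with $t(a)=h(b)$ and $ab\notin Z$, and at most one arrow $c$ with $h(c)=t(b)$ and $bc\notin Z$. A path is $Z$-admissible if it is not of the form $pzq$ with paths $p,q$ and $z\in Z$. A $Z$-primitive cycle is a path $c$ of positive length with $h(c)=t(c)$ such that $c^m$ is $Z$-admissible for all $m\ge 1$ and $c\neq d^k$ for every $k>1$ and every $Z$-admissible cycle $d$ shorter than $c$. Let $V(c)$ be the set of vertices traversed by $c$, let $V=\bigcup_c V(c)$ with $c$ running through the $Z$-primitive cycles, and let $V=V[1]\sqcup\dots\sqcup V[n]$ be the primitive-nerve partition, that is, the partition of $V$ into the classes of the transitive closure of the reflexive and symmetric relation $\bigcup_c V(c)\times V(c)$ on $V$. Let $(R,\mathfrak m)$ be a (commutative, noetherian) regular local ring of dimension $n$, and let $(s_1,\dots,s_n)$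 be a regular sequence that generates $\mathfrak m$. There are only finitely many $Z$-primitive cycles at each vertex $v$; let $\sigma_v\in RQ$ be their sum. Define the two-sided ideal $$I=\langle Z\rangle+\sum_{i=1}^n\Big(\langle s_ie_v-\sigma_v : v\in V[i]\rangle+\langle s_ie_v : v\in Q_0\setminus V[i]\rangle\Big)$$ of the path algebra $RQ$. Then every $Z$-admissible path lies outside $I$. Moreover, if $Q$ is biserial, then $\Lambda=RQ/I$ is a string algebra over $R$. This means the following, where $A_\ell\subseteq RQ$ is the $R$-span of the paths of length $\ell$, $A=\bigoplus_{\ell\ge1}A_\ell$, and $\mathfrak mQ$ is the set of $R$-linear combinations of paths with coefficients in $\mathfrak m$. (i) $I$ is admissible: $I\subseteq A+\mathfrak mQ$, $I\cap A\subseteq A^2+(\mathfrak mQ\cap A)$, and there are integers $m,h>0$ with $A^m\subseteq I+\mathfrak mQ$ and $\mathfrak mQ\subseteq I+\sum_{\ell=1}^hA_\ell$. (ii) $I$ is special: for every arrow $b$ there is at most one arrow $a$ with $t(a)=h(b)$ and $ab\notin I$, and at most one arrow $c$ with $h(c)=t(b)$ and $bc\notin I$. (iii) $I$ is arrow-direct: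 for every arrow $a$, one has $\Lambda a\cap\sum_b\Lambda b=0$, where $b$ runs over the arrows $b\ne a$ with $t(b)=t(a)$, and $a\Lambda\cap\sum_b b\Lambda=0$, where $b$ runs over the arrows $b\neq a$ with $h(b)=h(a)$. -/

import Mathlib

universe u v w

/-! ### Paths in a quiver

A quiver is given by Mathlib's `Quiver V`: the vertices are the elements of `V`, and an arrow `a`
with tail `t(a) = x` and head `h(a) = y` is an element of `x ⟶ y`. Note that Mathlib composes
paths in diagrammatic order, so that the path written `p q` (first `q`, then `p`) in the
right-to-left convention is `q.comp p`. -/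

/-- A path of arbitrary tail and head. -/
structure QPath (V : Type u) [Quiver.{v} V] where
  tail : V
  head : V
  path : Quiver.Path tail head

namespace QPath

variable {V : Type u} [Quiver.{v} V]

/-- The length of a path. -/
def length (p : QPath V) : ℕ := p.path.length

/-- The trivial path `e_x`. -/
def triv (x : V) : QPath V := ⟨x, x, Quiver.Path.nil⟩

/-- An arrow as a path of length one. -/
def ofArrow {x y : V} (a : x ⟶ y) : QPath V := ⟨x, y, a.toPath⟩

/-- The path of length two written `a b` from right to left: first `b`, then `a`. -/
def ofArrows {x y z : V} (a : y ⟶ z) (b : x ⟶ y) : QPath V := ⟨x, z, b.toPath.comp a.toPath⟩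

/-- The composition `p q` (first `q`, then `p`) of two composable paths. -/
def comp (p q : QPath V) (h : q.head = p.tail) : QPath V :=
  ⟨q.tail, p.head, (q.path.cast rfl h).comp p.path⟩

theorem comp_triv (p : QPath V) (x : V) (h : x = p.tail) : p.comp (triv x) h = p := by
  obtain ⟨a, b, p⟩ := p
  dsimp only at h
  subst h
  simp [comp, triv]

theorem triv_comp (p : QPath V) (x : V) (h : p.head = x) : (triv x).comp p h = p := by
  obtain ⟨a, b, p⟩ := p
  dsimp only at h
  subst h
  simp [comp, triv]

theorem comp_assoc (p q r : QPath V) (h : q.head = p.tail) (h' : r.head = q.tail) :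
    (p.comp q h).comp r h' = p.comp (q.comp r h') h := by
  obtain ⟨a, b, p⟩ := p
  obtain ⟨c, d, q⟩ := q
  obtain ⟨e, f, r⟩ := r
  dsimp only at h h'
  subst h h'
  simp [comp]

end QPath

/-! ### The path algebra -/

/-- The path algebra `RQ`: the free `R`-module on the paths, with multiplication induced by the
composition of paths (the product of two paths that do not compose being zero). -/
def PathAlgebra (R : Type w) [CommRing R] (V : Type u) [Quiver.{v} V] : Type (max u v w) :=
  QPath V →₀ R

namespace PathAlgebra

variable (R : Type w) [CommRing R] {V : Type u} [Quiver.{v} V]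

noncomputable instance : AddCommGroup (PathAlgebra R V) :=
  inferInstanceAs (AddCommGroup (QPath V →₀ R))

noncomputable instance : Module R (PathAlgebra R V) :=
  inferInstanceAs (Module R (QPath V →₀ R))

/-- The basis of `RQ` given by the paths. -/
noncomputable def basis : Module.Basis (QPath V) R (PathAlgebra R V) :=
  ⟨LinearEquiv.refl R (QPath V →₀ R)⟩

/-- A path, as an element of `RQ`. -/
noncomputable def ofPath (p : QPath V) : PathAlgebra R V := basis R p

open Classical in
/-- The product of two paths in `RQ`. -/
noncomputable def pathMul (p q : QPath V) : PathAlgebra R V :=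
  if h : q.head = p.tail then ofPath R (p.comp q h) else 0

/-- The multiplication of `RQ`, as a bilinear map. -/
noncomputable def mulLin : PathAlgebra R V →ₗ[R] PathAlgebra R V →ₗ[R] PathAlgebra R V :=
  (basis R).constr R fun p => (basis R).constr R fun q => pathMul R p q

theorem mulLin_ofPath (p q : QPath V) :
    mulLin R (ofPath R p) (ofPath R q) = pathMul R p q := by
  simp [mulLin, ofPath]

variable {R} in
theorem induction_linear {P : PathAlgebra R V → Prop} (x : PathAlgebra R V)
    (zero : P 0) (add : ∀ x y, P x → P y → P (x + y))
    (smul : ∀ (r : R) (p : QPath V), P (r • ofPath R p)) : P x := by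
  refine Finsupp.induction_linear (motive := P) x zero (fun f g hf hg => add f g hf hg) ?_
  intro p r
  have h := smul r p
  have e : r • ofPath R p = (Finsupp.single p r : QPath V →₀ R) := by
    change r • (Finsupp.single p (1 : R) : QPath V →₀ R) = _
    rw [Finsupp.smul_single, smul_eq_mul, mul_one]
  rw [e] at h
  exact h

theorem mulLin_assoc (x y z : PathAlgebra R V) :
    mulLin R (mulLin R x y) z = mulLin R x (mulLin R y z) := by
  have hz : ∀ p q r : QPath V, mulLin R (mulLin R (ofPath R p) (ofPath R q)) (ofPath R r)
      = mulLin R (ofPath R p) (mulLin R (ofPath R q) (ofPath R r)) := by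
    intro p q r
    rw [mulLin_ofPath, mulLin_ofPath]
    by_cases h : q.head = p.tail <;> by_cases h' : r.head = q.tail
    · have h1 : r.head = (p.comp q h).tail := h'
      have h2 : (q.comp r h').head = p.tail := h
      simp only [pathMul, h, h', dif_pos]
      rw [mulLin_ofPath, mulLin_ofPath]
      simp only [pathMul, h1, h2, dif_pos]
      exact congrArg _ (QPath.comp_assoc p q r h h')
    · have h1 : ¬ r.head = (p.comp q h).tail := h'
      simp only [pathMul, h, h', dif_pos, dif_neg, not_false_eq_true, map_zero]
      rw [mulLin_ofPath]
      simp only [pathMul, h1, dif_neg, not_false_eq_true]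
    · have h2 : ¬ (q.comp r h').head = p.tail := h
      simp only [pathMul, h, h', dif_pos, dif_neg, not_false_eq_true, map_zero,
        LinearMap.zero_apply]
      rw [mulLin_ofPath]
      simp only [pathMul, h2, dif_neg, not_false_eq_true]
    · simp [pathMul, h, h']
  induction x using induction_linear with
  | zero => simp
  | add x x' hx hx' => simp only [map_add, LinearMap.add_apply, hx, hx']
  | smul a p =>
    induction y using induction_linear with
    | zero => simp
    | add y y' hy hy' => simp only [map_add, LinearMap.add_apply, hy, hy']
    | smul b q =>
      induction z using induction_linear with
      | zero => simp
      | add z z' hz hz' => simp only [map_add, hz, hz']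
      | smul c r => simp only [map_smul, LinearMap.smul_apply, hz p q r]

/-- The element `e_x` of `RQ`. -/
noncomputable def e (x : V) : PathAlgebra R V := ofPath R (QPath.triv x)

/-- An arrow, as an element of `RQ`. -/
noncomputable def arrow {x y : V} (a : x ⟶ y) : PathAlgebra R V := ofPath R (QPath.ofArrow a)

theorem one_mulLin [Fintype V] (x : PathAlgebra R V) : mulLin R (∑ v : V, e R v) x = x := by
  classical
  induction x using induction_linear with
  | zero => simp
  | add x x' hx hx' => simp only [map_add, hx, hx']
  | smul a p =>
    rw [map_smul, map_sum, LinearMap.sum_apply]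
    congr 1
    rw [Finset.sum_eq_single p.head]
    · rw [e, mulLin_ofPath, pathMul, dif_pos (show p.head = (QPath.triv p.head).tail from rfl)]
      exact congrArg _ (QPath.triv_comp p p.head rfl)
    · intro b _ hb
      rw [e, mulLin_ofPath, pathMul, dif_neg]
      exact fun h => hb h.symm
    · simp

theorem mulLin_one [Fintype V] (x : PathAlgebra R V) : mulLin R x (∑ v : V, e R v) = x := by
  classical
  induction x using induction_linear with
  | zero => simp
  | add x x' hx hx' => simp only [map_add, LinearMap.add_apply, hx, hx']
  | smul a p =>
    rw [map_smul, map_sum]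
    rw [Finset.sum_eq_single p.tail]
    · rw [e, LinearMap.smul_apply, mulLin_ofPath, pathMul,
        dif_pos (show (QPath.triv p.tail).head = p.tail from rfl)]
      exact congrArg _ (congrArg _ (QPath.comp_triv p p.tail rfl))
    · intro b _ hb
      rw [e, LinearMap.smul_apply, mulLin_ofPath, pathMul, dif_neg, smul_zero]
      exact hb
    · simp

noncomputable instance [Fintype V] : Ring (PathAlgebra R V) where
  __ := (inferInstance : AddCommGroup (PathAlgebra R V))
  mul x y := mulLin R x y
  one := ∑ v : V, e R v
  left_distrib x y z := map_add (mulLin R x) y z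
  right_distrib x y z := by
    change mulLin R (x + y) z = mulLin R x z + mulLin R y z
    rw [map_add, LinearMap.add_apply]
  zero_mul x := by
    change mulLin R 0 x = 0
    rw [map_zero, LinearMap.zero_apply]
  mul_zero x := map_zero (mulLin R x)
  mul_assoc x y z := mulLin_assoc R x y z
  one_mul x := one_mulLin R x
  mul_one x := mulLin_one R x

noncomputable instance [Fintype V] : Algebra R (PathAlgebra R V) :=
  Algebra.ofModule
    (fun r x y => by
      change mulLin R (r • x) y = r • mulLin R x y
      rw [map_smul, LinearMap.smul_apply])
    (fun r x y => map_smul (mulLin R x) r y)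

end PathAlgebra

/-! ### Zero-relations, primitive cycles and the primitive-nerve partition -/

section Combinatorics

variable {V : Type u} [Quiver.{v} V]

/-- Every vertex is the head of at most two arrows and the tail of at most two arrows. -/
def IsBiserial (V : Type u) [Quiver.{v} V] : Prop :=
  ∀ x : V, ENat.card (Σ y : V, y ⟶ x) ≤ 2 ∧ ENat.card (Σ y : V, x ⟶ y) ≤ 2

/-- The pair `(Q, Z)` is special. -/
def IsSpecialPair (Z : Set (QPath V)) : Prop :=
  (∀ (x y : V) (b : x ⟶ y),
    {a : Σ z : V, y ⟶ z | QPath.ofArrows a.2 b ∉ Z}.Subsingleton) ∧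
  (∀ (x y : V) (b : x ⟶ y),
    {c : Σ z : V, z ⟶ x | QPath.ofArrows b c.2 ∉ Z}.Subsingleton)

/-- A path is `Z`-admissible if no element of `Z` is a subpath of it. -/
def IsZAdmissible (Z : Set (QPath V)) {x y : V} (p : Quiver.Path x y) : Prop :=
  ¬ ∃ z ∈ Z, ∃ (q : Quiver.Path x z.tail) (r : Quiver.Path z.head y),
    p = (q.comp z.path).comp r

/-- The powers of a path with equal head and tail. -/
def cyclePow {x : V} (c : Quiver.Path x x) : ℕ → Quiver.Path x x
  | 0 => Quiver.Path.nil
  | n + 1 => (cyclePow c n).comp c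

/-- `Z`-primitive cycles at the vertex `x`. -/
structure IsPrimitiveCycle (Z : Set (QPath V)) {x : V} (c : Quiver.Path x x) : Prop where
  nontrivial : 0 < c.length
  admissible : ∀ n : ℕ, 0 < n → IsZAdmissible Z (cyclePow c n)
  not_power : ¬ ∃ d : Quiver.Path x x, 0 < d.length ∧ d.length < c.length ∧ IsZAdmissible Z d ∧
    ∃ k : ℕ, 1 < k ∧ c = cyclePow d k

/-- The relation `⋃_c V(c) × V(c)`, where `c` runs through the `Z`-primitive cycles and `V(c)` is
the set of vertices traversed by `c`. -/
def PrimRel (Z : Set (QPath V)) (x y : V) : Prop :=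
  ∃ (z : V) (c : Quiver.Path z z), IsPrimitiveCycle Z c ∧ x ∈ c.vertices ∧ y ∈ c.vertices

/-- A primitive vertex is one that is traversed by some `Z`-primitive cycle. -/
def IsPrimitiveVertex (Z : Set (QPath V)) (x : V) : Prop :=
  ∃ (z : V) (c : Quiver.Path z z), IsPrimitiveCycle Z c ∧ x ∈ c.vertices

/-- The parts of the primitive-nerve partition: the classes of primitive vertices under the
transitive closure of `PrimRel Z` (which is reflexive on primitive vertices, and symmetric). -/
def nerveParts (Z : Set (QPath V)) : Set (Set V) :=
  {S | ∃ x, IsPrimitiveVertex Z x ∧ S = {y | Relation.TransGen (PrimRel Z) x y}}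

/-- `P 0, …, P (n - 1)` are the parts, each listed exactly once, of the primitive-nerve
partition. -/
structure IsPrimitiveNervePartition (Z : Set (QPath V)) {n : ℕ} (P : Fin n → Set V) : Prop where
  injective : Function.Injective P
  range_eq : Set.range P = nerveParts Z

end Combinatorics

/-! ### Ideals of the path algebra -/

section Ideals

variable (R : Type w) [CommRing R] {V : Type u} [Quiver.{v} V]

/-- `σ_x`, the sum of the `Z`-primitive cycles at `x` (finitely many, if `Q` is finite and
`(Q, Z)` is special). -/
noncomputable def sigma (Z : Set (QPath V)) (x : V) : PathAlgebra R V :=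
  ∑ᶠ c ∈ {c : Quiver.Path x x | IsPrimitiveCycle Z c}, PathAlgebra.ofPath R ⟨x, x, c⟩

/-- The `R`-span `A_ℓ` of the paths of length `ℓ`. -/
noncomputable def lengthSpan (V : Type u) [Quiver.{v} V] (l : ℕ) : Submodule R (PathAlgebra R V) :=
  Submodule.span R {x | ∃ p : QPath V, p.length = l ∧ x = PathAlgebra.ofPath R p}

/-- `A`, the sum of the `A_ℓ` with `ℓ ≥ 1`. -/
noncomputable def arrowIdeal (V : Type u) [Quiver.{v} V] : Submodule R (PathAlgebra R V) :=
  ⨆ l ∈ Set.Ici 1, lengthSpan R V l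

variable {R}

/-- `𝔞Q`, the linear combinations of paths with coefficients in `𝔞`. -/
noncomputable def coeffIdeal (𝔞 : Ideal R) (V : Type u) [Quiver.{v} V] : Submodule R (PathAlgebra R V) where
  carrier := {x | ∀ p : QPath V, (PathAlgebra.basis R).repr x p ∈ 𝔞}
  add_mem' hx hy p := by
    rw [map_add, Finsupp.add_apply]
    exact 𝔞.add_mem (hx p) (hy p)
  zero_mem' p := by
    rw [map_zero, Finsupp.zero_apply]
    exact 𝔞.zero_mem
  smul_mem' r x hx p := by
    rw [map_smul, Finsupp.smul_apply]
    exact 𝔞.mul_mem_left r (hx p)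

variable [Fintype V]

/-- The `R`-submodule of `RQ` underlying a two-sided ideal. -/
noncomputable def idealSubmodule (I : TwoSidedIdeal (PathAlgebra R V)) : Submodule R (PathAlgebra R V) :=
  (TwoSidedIdeal.asIdeal I).restrictScalars R

/-- Admissible ideals of `RQ`, for a local ring `R`. -/
structure IsAdmissibleIdeal [IsLocalRing R] (I : TwoSidedIdeal (PathAlgebra R V)) : Prop where
  le_add : idealSubmodule I ≤ arrowIdeal R V ⊔ coeffIdeal (IsLocalRing.maximalIdeal R) V
  inf_le : idealSubmodule I ⊓ arrowIdeal R V ≤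
    arrowIdeal R V ^ 2 ⊔ coeffIdeal (IsLocalRing.maximalIdeal R) V ⊓ arrowIdeal R V
  pow_le : ∃ m : ℕ, 0 < m ∧
    arrowIdeal R V ^ m ≤ idealSubmodule I ⊔ coeffIdeal (IsLocalRing.maximalIdeal R) V
  coeff_le : ∃ h : ℕ, 0 < h ∧
    coeffIdeal (IsLocalRing.maximalIdeal R) V ≤
      idealSubmodule I ⊔ ⨆ l ∈ Set.Icc 1 h, lengthSpan R V l

/-- Special ideals of `RQ`. -/
def IsSpecialIdeal (I : TwoSidedIdeal (PathAlgebra R V)) : Prop :=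
  (∀ (x y : V) (b : x ⟶ y),
    {a : Σ z : V, y ⟶ z | PathAlgebra.arrow R a.2 * PathAlgebra.arrow R b ∉ I}.Subsingleton) ∧
  (∀ (x y : V) (b : x ⟶ y),
    {c : Σ z : V, z ⟶ x | PathAlgebra.arrow R b * PathAlgebra.arrow R c.2 ∉ I}.Subsingleton)

/-- The image of an arrow in the quotient algebra `Λ = RQ / I`. -/
noncomputable def quotArrow (I : TwoSidedIdeal (PathAlgebra R V)) {x y : V} (a : x ⟶ y) : I.ringCon.Quotient :=
  I.ringCon.mk' (PathAlgebra.arrow R a)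

/-- Arrow-direct ideals of `RQ`: in `Λ = RQ / I`, for any arrow `a` one has `Λ a ∩ ∑ Λ b = 0`,
where `b ≠ a` runs through the other arrows with the same tail, and `a Λ ∩ ∑ b Λ = 0`, where
`b ≠ a` runs through the other arrows with the same head. Right ideals are submodules over the
opposite ring. -/
def IsArrowDirect (I : TwoSidedIdeal (PathAlgebra R V)) : Prop :=
  ∀ (x y : V) (a : x ⟶ y),
    (Submodule.span I.ringCon.Quotient {quotArrow I a} ⊓
      (⨆ b ∈ {b : Σ z : V, x ⟶ z | b ≠ ⟨y, a⟩},
        Submodule.span I.ringCon.Quotient {quotArrow I b.2}) = ⊥) ∧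
    (Submodule.span I.ringCon.Quotientᵐᵒᵖ {quotArrow I a} ⊓
      (⨆ b ∈ {b : Σ z : V, z ⟶ y | b ≠ ⟨x, a⟩},
        Submodule.span I.ringCon.Quotientᵐᵒᵖ {quotArrow I b.2}) = ⊥)

/-- The quotient `RQ / I` is (presented by `Q` and `I` as) a string algebra over `R`. -/
structure IsStringAlgebra [IsLocalRing R] (I : TwoSidedIdeal (PathAlgebra R V)) : Prop where
  biserial : IsBiserial V
  admissible : IsAdmissibleIdeal I
  special : IsSpecialIdeal I
  arrowDirect : IsArrowDirect I

/-- The ideal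
`I = ⟨Z⟩ + ∑_i (⟨s_i e_x - σ_x : x ∈ P i⟩ + ⟨s_i e_x : x ∉ P i⟩)`. -/
noncomputable def stringIdeal (Z : Set (QPath V)) {n : ℕ} (P : Fin n → Set V) (s : Fin n → R) :
    TwoSidedIdeal (PathAlgebra R V) :=
  TwoSidedIdeal.span (PathAlgebra.ofPath R '' Z) ⊔
    ⨆ i : Fin n,
      (TwoSidedIdeal.span {y | ∃ x ∈ P i, y = s i • PathAlgebra.e R x - sigma R Z x} ⊔
        TwoSidedIdeal.span {y | ∃ x ∉ P i, y = s i • PathAlgebra.e R x})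

end Ideals

/-! Specialness gives every arrow at most one admissible successor and at most one admissible
predecessor. So an admissible path is determined by its first arrow and its length, and a primitive
cycle runs exactly once through the orbit of its first arrow under the successor map. Consequently a
nontrivial path can be admissibly preceded by at most one primitive cycle, and every sufficiently
long admissible path begins with one (`exists_bound_eq_comp`).

The relators `s_i e_x - σ_x` (`x ∈ P i`) and `s_i e_x` (`x ∉ P i`) commute with arrows modulo the
non-admissible paths (`relator_mul_arrow_sub_mem`), because rotations of primitive cycles are
primitive and the vertices of a cycle lie in one part. Hence left multiples of relators, together
with the non-admissible paths, already form the two-sided ideal `I`. Modulo non-admissible paths, a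
nontrivial path `p` times a relator is either `s_i p` or `s_i p - p c`, with `c` the unique
primitive cycle that can precede `p`. Let `K` (`pathRelations`) be the span of these elements and of
the non-admissible paths.

The crux is `I ∩ A = K`, of which `stringIdeal_inf_arrowIdeal_le` is the hard inclusion. If a
combination of the relators at `x` with coefficients `c_i` has no `e_x`-term, then `∑ c_i s_i = 0`.
Regularity puts `c_i` into the ideal of the `s_j` with `j ≠ i`, and `s_j σ_x ∈ K` for `x ∈ P i`
because distinct parts are disjoint.

The claims are then read off `K`. Its relations respect first and last arrows, which gives
arrow-directness by projection. A nontrivial admissible path that properly extends a primitive cycle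
`c` at a vertex of `P i` is separated from `K` by counting turns around `c` with powers of `s_i`
modulo the other `s_j`; any other one is separated by its coefficient modulo the maximal ideal.
Finally, `p c ≡ s_i p` shortens long paths, which yields the two bounds in admissibility. -/

/-! ### Words of arrows -/

section Words

open Quiver

variable {V : Type u} [Quiver.{v} V]

/-- The arrows of a quiver, with arbitrary tail and head. -/
abbrev TotalArrow (V : Type u) [Quiver.{v} V] := Σ x : V, Σ y : V, (x ⟶ y)

namespace Quiver.Path

/-- The word of arrows traversed by a path, from its tail to its head. -/
def arrows {x : V} : ∀ {y : V}, Path x y → List (TotalArrow V)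
  | _, nil => []
  | _, cons p e => arrows p ++ [⟨_, _, e⟩]

@[simp] theorem arrows_nil (x : V) : (nil : Path x x).arrows = [] := rfl

@[simp] theorem arrows_cons {x y z : V} (p : Path x y) (e : y ⟶ z) :
    (p.cons e).arrows = p.arrows ++ [⟨_, _, e⟩] := rfl

@[simp] theorem arrows_toPath {x y : V} (e : x ⟶ y) :
    e.toPath.arrows = [⟨x, y, e⟩] := rfl

@[simp] theorem arrows_comp {x y z : V} (p : Path x y) (q : Path y z) :
    (p.comp q).arrows = p.arrows ++ q.arrows := by
  induction q with
  | nil => simp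
  | cons q e ih => simp [ih]

@[simp] theorem length_arrows {x y : V} (p : Path x y) : p.arrows.length = p.length := by
  induction p with
  | nil => rfl
  | cons p e ih => simp [ih]

/-- The heads are not assumed equal, so the comparison takes place in `QPath`; a case split on the
conclusion then identifies head and path at once. -/
theorem mk_eq_of_arrows_eq {x y z : V} (p : Path x y) (q : Path x z) (h : p.arrows = q.arrows) :
    (⟨x, y, p⟩ : QPath V) = ⟨x, z, q⟩ := by
  induction p generalizing z with
  | nil =>
    cases q with
    | nil => rfl
    | cons q e => simp at h
  | cons p e ih =>
    cases q with
    | nil => simp at h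
    | cons q e' =>
      simp only [arrows_cons] at h
      obtain ⟨h1, h2⟩ := List.append_inj' h rfl
      have h3 := ih q h1
      cases h3
      simp only [List.cons.injEq, and_true] at h2
      cases h2
      rfl

theorem arrows_injective {x y : V} {p q : Path x y} (h : p.arrows = q.arrows) : p = q := by
  have := mk_eq_of_arrows_eq p q h
  cases this
  rfl

theorem exists_head?_arrows {x y : V} (p : Path x y) (h : 0 < p.length) :
    ∃ b, p.arrows.head? = some b := by
  rw [← length_arrows] at h
  exact ⟨_, List.head?_eq_some_head (List.length_pos_iff.mp h)⟩

theorem fst_of_head?_arrows {x y : V} {p : Path x y} {b : TotalArrow V}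
    (h : p.arrows.head? = some b) : b.1 = x := by
  obtain ⟨n, hn⟩ : ∃ n, p.length = n + 1 := by
    refine Nat.exists_eq_succ_of_ne_zero fun h0 => ?_
    rw [← length_arrows, List.length_eq_zero_iff] at h0
    simp [h0] at h
  obtain ⟨z, e, q, -, rfl⟩ := p.eq_toPath_comp_of_length_eq_succ hn
  simp at h
  rw [← h]

theorem exists_toPath_comp_of_head?_arrows {x y z : V} {p : Path x z} {e : x ⟶ y}
    (h : p.arrows.head? = some ⟨x, y, e⟩) : ∃ q : Path y z, p = e.toPath.comp q := by
  obtain ⟨n, hn⟩ : ∃ n, p.length = n + 1 := by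
    refine Nat.exists_eq_succ_of_ne_zero fun h0 => ?_
    rw [← length_arrows, List.length_eq_zero_iff] at h0
    simp [h0] at h
  obtain ⟨z, e', q, -, rfl⟩ := p.eq_toPath_comp_of_length_eq_succ hn
  simp at h
  obtain ⟨rfl, h⟩ := h
  cases h
  exact ⟨q, rfl⟩

theorem head?_arrows_comp {x y z : V} {p : Path x y} (q : Path y z) (h : 0 < p.length) :
    (p.comp q).arrows.head? = p.arrows.head? := by
  rw [← length_arrows] at h
  rw [arrows_comp, List.head?_append_of_ne_nil _ (List.length_pos_iff.mp h)]

theorem getLast?_arrows_comp {x y z : V} (p : Path x y) {q : Path y z} (h : 0 < q.length) :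
    (p.comp q).arrows.getLast? = q.arrows.getLast? := by
  rw [← length_arrows] at h
  rw [arrows_comp, List.getLast?_append_of_ne_nil _ (List.length_pos_iff.mp h)]

end Quiver.Path

open Quiver.Path

theorem cyclePow_one {x : V} (c : Path x x) : cyclePow c 1 = c := by
  simp [cyclePow]

theorem cyclePow_succ' {x : V} (c : Path x x) (n : ℕ) :
    cyclePow c (n + 1) = c.comp (cyclePow c n) := by
  induction n with
  | zero => simp [cyclePow]
  | succ n ih =>
    rw [cyclePow, ih, comp_assoc, ← ih]
    rfl

theorem length_cyclePow {x : V} (c : Path x x) (n : ℕ) :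
    (cyclePow c n).length = n * c.length := by
  induction n with
  | zero => simp [cyclePow]
  | succ n ih => rw [cyclePow, length_comp, ih]; ring

theorem cyclePow_comp {x y : V} (r : Path x y) (q : Path y x) (n : ℕ) :
    cyclePow (r.comp q) (n + 1) = (r.comp (cyclePow (q.comp r) n)).comp q := by
  induction n with
  | zero => simp [cyclePow]
  | succ n ih =>
    rw [cyclePow, ih]
    conv_rhs => rw [cyclePow]
    simp only [comp_assoc]

end Words

/-! ### Admissible paths -/

section Admissible

open Quiver Quiver.Path

variable {V : Type u} [Quiver.{v} V] {Z : Set (QPath V)}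

theorem IsZAdmissible.of_comp_left {x y z : V} {p : Path x y} {q : Path y z}
    (h : IsZAdmissible Z (p.comp q)) : IsZAdmissible Z p := by
  rintro ⟨z, hz, a, b, rfl⟩
  exact h ⟨z, hz, a, b.comp q, by simp only [comp_assoc]⟩

theorem IsZAdmissible.of_comp_right {x y z : V} {p : Path x y} {q : Path y z}
    (h : IsZAdmissible Z (p.comp q)) : IsZAdmissible Z q := by
  rintro ⟨z, hz, a, b, rfl⟩
  exact h ⟨z, hz, p.comp a, b, by simp only [comp_assoc]⟩

theorem two_le_length_of_not_isZAdmissible (hZ : ∀ z ∈ Z, 2 ≤ z.length) {x y : V} {p : Path x y}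
    (h : ¬ IsZAdmissible Z p) : 2 ≤ p.length := by
  obtain ⟨z, hz, a, b, rfl⟩ := not_not.mp h
  have : 2 ≤ z.path.length := hZ z hz
  simp only [length_comp]
  omega

/-- The arrow `a` can follow the arrow `b`: they compose and `a b ∉ Z`. -/
inductive Follows (Z : Set (QPath V)) : TotalArrow V → TotalArrow V → Prop
  | intro {x y z : V} (b : x ⟶ y) (a : y ⟶ z) (h : QPath.ofArrows a b ∉ Z) :
      Follows Z ⟨x, y, b⟩ ⟨y, z, a⟩

theorem Follows.right_unique (hsp : IsSpecialPair Z) {b a a' : TotalArrow V}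
    (h : Follows Z b a) (h' : Follows Z b a') : a = a' := by
  obtain ⟨b, a, h⟩ := h
  cases h' with
  | intro b a' h' =>
    have := hsp.1 _ _ b (show ⟨_, a⟩ ∈ _ from h) (show ⟨_, a'⟩ ∈ _ from h')
    cases this
    rfl

theorem Follows.left_unique (hsp : IsSpecialPair Z) {b b' a : TotalArrow V}
    (h : Follows Z b a) (h' : Follows Z b' a) : b = b' := by
  obtain ⟨b, a, h⟩ := h
  cases h' with
  | intro b' a h' =>
    have := hsp.2 _ _ a (show ⟨_, b⟩ ∈ _ from h) (show ⟨_, b'⟩ ∈ _ from h')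
    cases this
    rfl

theorem IsZAdmissible.isChain {x y : V} {p : Path x y} (h : IsZAdmissible Z p) :
    p.arrows.IsChain (Follows Z) := by
  induction p with
  | nil => simp
  | cons p e ih =>
    rw [arrows_cons, List.isChain_append]
    refine ⟨ih (IsZAdmissible.of_comp_left (q := e.toPath) h), by simp, ?_⟩
    cases p with
    | nil => simp
    | cons p e' =>
      simp only [arrows_cons, List.getLast?_append, List.getLast?_singleton, Option.some_or,
        Option.mem_def, Option.some.injEq, List.head?_cons]
      rintro _ rfl _ rfl
      refine Follows.intro e' e fun hz => h ⟨_, hz, p, nil, ?_⟩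
      rfl

open Classical in
/-- The arrow that follows a given arrow, if there is one. -/
noncomputable def nextArrow (Z : Set (QPath V)) (b : TotalArrow V) : TotalArrow V :=
  -- With this default an arrow without successor is a fixed point, so periodicity alone does not
  -- produce a cycle; admissibility has to be supplied separately.
  if h : ∃ a, Follows Z b a then h.choose else b

theorem Follows.nextArrow_eq (hsp : IsSpecialPair Z) {b a : TotalArrow V} (h : Follows Z b a) :
    nextArrow Z b = a := by
  have h' : ∃ a, Follows Z b a := ⟨a, h⟩
  rw [nextArrow, dif_pos h']
  exact h'.choose_spec.right_unique hsp h

theorem isChain_follows_eq_iterate (hsp : IsSpecialPair Z) {l : List (TotalArrow V)}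
    (hl : l.IsChain (Follows Z)) {b : TotalArrow V} (hb : l.head? = some b) :
    l = List.iterate (nextArrow Z) b l.length := by
  induction l generalizing b with
  | nil => simp at hb
  | cons a l ih =>
    simp only [List.head?_cons, Option.some.injEq] at hb
    subst hb
    rw [List.length_cons, List.iterate]
    congr 1
    cases l with
    | nil => rfl
    | cons a' l =>
      rw [List.isChain_cons_cons] at hl
      rw [hl.1.nextArrow_eq hsp]
      exact ih hl.2 rfl

/-- This turns questions about admissible paths into questions about orbits of one self-map on the
arrows. -/
theorem IsZAdmissible.arrows_eq_iterate (hsp : IsSpecialPair Z) {x y : V} {p : Path x y} (h : IsZAdmissible Z p)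
    {b : TotalArrow V} (hb : p.arrows.head? = some b) :
    p.arrows = List.iterate (nextArrow Z) b p.length := by
  rw [← length_arrows]
  exact isChain_follows_eq_iterate hsp h.isChain hb

theorem IsZAdmissible.mk_eq (hsp : IsSpecialPair Z) {x y z : V} {p : Path x y} {q : Path x z}
    (hp : IsZAdmissible Z p) (hq : IsZAdmissible Z q) (h : p.arrows.head? = q.arrows.head?)
    (hl : p.length = q.length) : (⟨x, y, p⟩ : QPath V) = ⟨x, z, q⟩ := by
  apply mk_eq_of_arrows_eq
  rcases Nat.eq_zero_or_pos p.length with h0 | h0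
  · rw [List.length_eq_zero_iff.mp (p.length_arrows.trans h0),
      List.length_eq_zero_iff.mp (q.length_arrows.trans (hl ▸ h0))]
  · obtain ⟨b, hb⟩ := p.exists_head?_arrows h0
    rw [hp.arrows_eq_iterate hsp hb, hq.arrows_eq_iterate hsp (h ▸ hb), hl]

theorem IsZAdmissible.eq (hsp : IsSpecialPair Z) {x y : V} {p q : Path x y}
    (hp : IsZAdmissible Z p) (hq : IsZAdmissible Z q) (h : p.arrows.head? = q.arrows.head?)
    (hl : p.length = q.length) : p = q := by
  have := hp.mk_eq hsp hq h hl
  cases this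
  rfl

theorem IsZAdmissible.exists_eq_comp (hsp : IsSpecialPair Z) {x y z : V} {p : Path x y}
    {q : Path x z} (hp : IsZAdmissible Z p) (hq : IsZAdmissible Z q) (h0 : 0 < p.length)
    (h : p.arrows.head? = q.arrows.head?) (hl : p.length ≤ q.length) :
    ∃ r : Path y z, q = p.comp r := by
  obtain ⟨w, d, r, rfl, hd⟩ := q.exists_eq_comp_of_le_length hl
  have hd0 : 0 < d.length := hd ▸ h0
  rw [head?_arrows_comp r hd0] at h
  have := hp.mk_eq hsp hq.of_comp_left h hd.symm
  cases this
  exact ⟨r, rfl⟩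

theorem IsZAdmissible.head?_right (hsp : IsSpecialPair Z) {x y z : V} {p : Path x y}
    {q : Path y z} (h : IsZAdmissible Z (p.comp q)) (hp : 0 < p.length) (hq : 0 < q.length)
    {b : TotalArrow V} (hb : p.arrows.head? = some b) :
    q.arrows.head? = some ((nextArrow Z)^[p.length] b) := by
  have h1 := h.arrows_eq_iterate hsp ((head?_arrows_comp q hp).trans hb)
  rw [arrows_comp, length_comp, List.iterate_add] at h1
  have h2 := (List.append_inj h1 (by simp)).2
  rw [h2]
  obtain ⟨n, hn⟩ := Nat.exists_eq_succ_of_ne_zero hq.ne'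
  rw [hn]
  rfl

/-- All the powers of the cycle `c` are admissible. -/
def PowersAdmissible (Z : Set (QPath V)) {x : V} (c : Path x x) : Prop :=
  ∀ n : ℕ, 0 < n → IsZAdmissible Z (cyclePow c n)

theorem PowersAdmissible.isZAdmissible {x : V} {c : Path x x} (h : PowersAdmissible Z c) :
    IsZAdmissible Z c := by
  simpa [cyclePow_one] using h 1 one_pos

theorem PowersAdmissible.comp_self {x : V} {c : Path x x} (h : PowersAdmissible Z c) :
    IsZAdmissible Z (c.comp c) := by
  simpa [cyclePow] using h 2 two_pos

theorem PowersAdmissible.isPeriodicPt (hsp : IsSpecialPair Z) {x : V} {c : Path x x}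
    (h : PowersAdmissible Z c) (hc : 0 < c.length) {b : TotalArrow V}
    (hb : c.arrows.head? = some b) : Function.IsPeriodicPt (nextArrow Z) c.length b := by
  have := h.comp_self.head?_right hsp hc hc hb
  rw [hb] at this
  exact (Option.some.inj this).symm

theorem arrows_cyclePow {x : V} {c : Path x x} {f : TotalArrow V → TotalArrow V}
    {b : TotalArrow V} (hc : c.arrows = List.iterate f b c.length)
    (hb : Function.IsPeriodicPt f c.length b) (n : ℕ) :
    (cyclePow c n).arrows = List.iterate f b (n * c.length) := by
  induction n with
  | zero => simp [cyclePow]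
  | succ n ih =>
    rw [cyclePow, arrows_comp, ih, add_mul, one_mul, List.iterate_add]
    rw [show f^[n * c.length] b = b from hb.const_mul n, ← hc]

/-- The arrow at position `t` is again `b`, so the first `t` arrows return to the tail of `b`. The
inequality `t < p.length` is strict so that this arrow exists. -/
theorem exists_cycle_eq_comp (hsp : IsSpecialPair Z) {x y : V} {p : Path x y}
    (hp : IsZAdmissible Z p) {b : TotalArrow V} (hb : p.arrows.head? = some b) {t : ℕ}
    (ht : 0 < t) (htp : t < p.length) (hper : Function.IsPeriodicPt (nextArrow Z) t b) :
    ∃ (d : Path x x) (e : Path x y), p = d.comp e ∧ d.length = t := by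
  obtain ⟨w, d, e, rfl, hd⟩ := p.exists_eq_comp_of_le_length htp.le
  have hd0 : 0 < d.length := hd ▸ ht
  rw [head?_arrows_comp e hd0] at hb
  have he := hp.head?_right hsp hd0 (by rw [length_comp] at htp; omega) hb
  rw [hd, hper] at he
  obtain rfl : w = x := (fst_of_head?_arrows he).symm.trans (fst_of_head?_arrows hb)
  exact ⟨d, e, rfl, hd⟩

/-! ### Primitive cycles as periodic orbits -/

theorem IsPrimitiveCycle.powersAdmissible {x : V} {c : Path x x} (h : IsPrimitiveCycle Z c) :
    PowersAdmissible Z c := h.admissible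

theorem IsPrimitiveCycle.isZAdmissible {x : V} {c : Path x x} (h : IsPrimitiveCycle Z c) :
    IsZAdmissible Z c := h.powersAdmissible.isZAdmissible

/-- The length is a period of the first arrow. If it were not the minimal one, the initial segment
of minimal period length would be a shorter admissible cycle having `c` as a proper power. -/
theorem IsPrimitiveCycle.length_eq (hsp : IsSpecialPair Z) {x : V} {c : Path x x}
    (h : IsPrimitiveCycle Z c) {b : TotalArrow V} (hb : c.arrows.head? = some b) :
    c.length = Function.minimalPeriod (nextArrow Z) b := by
  have hper := h.powersAdmissible.isPeriodicPt hsp h.nontrivial hb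
  set t := Function.minimalPeriod (nextArrow Z) b with ht
  have ht0 : 0 < t := hper.minimalPeriod_pos h.nontrivial
  have htp : Function.IsPeriodicPt (nextArrow Z) t b := Function.isPeriodicPt_minimalPeriod _ _
  obtain ⟨k, hk⟩ := hper.minimalPeriod_dvd
  refine (hper.minimalPeriod_le h.nontrivial).antisymm' (not_lt.mp fun hlt => ?_)
  obtain ⟨d, e, hde, hd⟩ := exists_cycle_eq_comp hsp h.isZAdmissible hb ht0 hlt htp
  have hdadm : IsZAdmissible Z d := (hde ▸ h.isZAdmissible).of_comp_left
  have hdb : d.arrows.head? = some b := by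
    rw [← hb, hde, head?_arrows_comp e (hd ▸ ht0)]
  refine h.not_power ⟨d, hd ▸ ht0, hd ▸ hlt, hdadm, k, ?_, ?_⟩
  · by_contra hk1
    have : k ≤ 1 := by omega
    rw [hk] at hlt
    nlinarith
  · apply arrows_injective
    rw [arrows_cyclePow (hdadm.arrows_eq_iterate hsp hdb) (hd.symm ▸ htp),
      h.isZAdmissible.arrows_eq_iterate hsp hb, hk, hd, mul_comm]

theorem isPrimitiveCycle_of_length_eq (hsp : IsSpecialPair Z) {x : V} {c : Path x x}
    (h0 : 0 < c.length) (h : PowersAdmissible Z c) {b : TotalArrow V}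
    (hb : c.arrows.head? = some b) (hl : c.length = Function.minimalPeriod (nextArrow Z) b) :
    IsPrimitiveCycle Z c := by
  refine ⟨h0, h, ?_⟩
  rintro ⟨d, hd0, hdl, -, k, hk, rfl⟩
  obtain ⟨k, rfl⟩ := Nat.exists_eq_add_of_lt hk
  rw [show 1 + k + 1 = k + 1 + 1 by ring] at *
  have hadm := h.isZAdmissible
  rw [cyclePow_succ'] at hb hadm
  rw [head?_arrows_comp _ hd0] at hb
  have h1 : 0 < (cyclePow d (k + 1)).length := by
    rw [length_cyclePow]; positivity
  have h2 := hadm.head?_right hsp hd0 h1 hb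
  rw [cyclePow_succ', head?_arrows_comp _ hd0, hb] at h2
  have h3 : Function.IsPeriodicPt (nextArrow Z) d.length b := (Option.some.inj h2).symm
  have := h3.minimalPeriod_le hd0
  omega

theorem IsPrimitiveCycle.eq (hsp : IsSpecialPair Z) {x : V} {c d : Path x x}
    (hc : IsPrimitiveCycle Z c) (hd : IsPrimitiveCycle Z d)
    (h : c.arrows.head? = d.arrows.head?) : c = d := by
  obtain ⟨b, hb⟩ := c.exists_head?_arrows hc.nontrivial
  exact hc.isZAdmissible.eq hsp hd.isZAdmissible h
    ((hc.length_eq hsp hb).trans (hd.length_eq hsp (h ▸ hb)).symm)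

theorem finite_setOf_isPrimitiveCycle [Finite (TotalArrow V)] (hsp : IsSpecialPair Z) (x : V) :
    {c : Path x x | IsPrimitiveCycle Z c}.Finite :=
  Set.Finite.of_injOn (f := fun c => c.arrows.head?) (t := Set.univ) (Set.mapsTo_univ _ _)
    (fun _ hc _ hd h => IsPrimitiveCycle.eq hsp hc hd h) Set.finite_univ

/-- After one turn the orbit is back at the first arrow of `c`, and this is where `p` has to begin.
-/
theorem IsPrimitiveCycle.head?_eq (hsp : IsSpecialPair Z) {x y : V} {c : Path x x}
    (hc : IsPrimitiveCycle Z c) {p : Path x y} (hp : 0 < p.length)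
    (h : IsZAdmissible Z (c.comp p)) : c.arrows.head? = p.arrows.head? := by
  obtain ⟨b, hb⟩ := c.exists_head?_arrows hc.nontrivial
  rw [h.head?_right hsp hc.nontrivial hp hb,
    hc.powersAdmissible.isPeriodicPt hsp hc.nontrivial hb, hb]

theorem IsPrimitiveCycle.eq_of_comp (hsp : IsSpecialPair Z) {x y : V} {c d : Path x x}
    (hc : IsPrimitiveCycle Z c) (hd : IsPrimitiveCycle Z d) {p : Path x y} (hp : 0 < p.length)
    (h : IsZAdmissible Z (c.comp p)) (h' : IsZAdmissible Z (d.comp p)) : c = d :=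
  hc.eq hsp hd ((hc.head?_eq hsp hp h).trans (hd.head?_eq hsp hp h').symm)

theorem IsPrimitiveCycle.comp_isZAdmissible (hsp : IsSpecialPair Z) {x y : V} {c : Path x x}
    (hc : IsPrimitiveCycle Z c) {p : Path x y} (hp : 0 < p.length) (hadm : IsZAdmissible Z p)
    (h : c.arrows.head? = p.arrows.head?) : IsZAdmissible Z (c.comp p) := by
  obtain ⟨n, hn⟩ := Nat.exists_eq_succ_of_ne_zero hp.ne'
  have h1 : p.arrows.head? = (cyclePow c (n + 1)).arrows.head? := by
    rw [cyclePow_succ', head?_arrows_comp _ hc.nontrivial, h]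
  -- `p` is an initial segment of a power of `c`, the exponent `p.length` being large enough; one
  -- more turn in front is an initial segment of the next power.
  obtain ⟨r, hr⟩ := hadm.exists_eq_comp hsp (hc.admissible (n + 1) n.succ_pos) hp h1 (by
    rw [length_cyclePow, hn]
    exact Nat.le_mul_of_pos_right _ hc.nontrivial)
  have h2 := hc.admissible (n + 1 + 1) (Nat.succ_pos _)
  rw [cyclePow_succ', hr, ← comp_assoc] at h2
  exact h2.of_comp_left

/-- Powers of `q.comp r` are subpaths of powers of `r.comp q`, and the two first arrows lie on one
periodic orbit, hence have the same minimal period. -/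
theorem IsPrimitiveCycle.rotate (hsp : IsSpecialPair Z) {x y : V} {r : Path x y} {q : Path y x}
    (h : IsPrimitiveCycle Z (r.comp q)) : IsPrimitiveCycle Z (q.comp r) := by
  rcases Nat.eq_zero_or_pos r.length with h0 | h0
  · cases r with
    | nil => simpa using h
    | cons r e => simp at h0
  have hlen : (q.comp r).length = (r.comp q).length := by
    simp only [length_comp, add_comm]
  have hpos : 0 < (q.comp r).length := hlen ▸ h.nontrivial
  have hpow : PowersAdmissible Z (q.comp r) := by
    intro n _
    have := h.admissible (n + 1) n.succ_pos
    rw [cyclePow_comp] at this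
    exact this.of_comp_left.of_comp_right
  obtain ⟨b, hb⟩ := r.exists_head?_arrows h0
  have hb' : (r.comp q).arrows.head? = some b := (head?_arrows_comp q h0).trans hb
  have hadm : IsZAdmissible Z (r.comp (q.comp r)) := by
    have := h.admissible 2 two_pos
    rw [cyclePow_comp, cyclePow_one] at this
    exact this.of_comp_left
  refine isPrimitiveCycle_of_length_eq hsp hpos hpow (hadm.head?_right hsp h0 hpos hb) ?_
  rw [Function.minimalPeriod_apply_iterate, hlen, h.length_eq hsp hb']
  exact ⟨_, h.nontrivial, h.powersAdmissible.isPeriodicPt hsp h.nontrivial hb'⟩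

theorem IsPrimitiveCycle.exists_comp_toPath (hsp : IsSpecialPair Z) {x y : V} {a : x ⟶ y}
    {c : Path x x} (hc : IsPrimitiveCycle Z c) (h : IsZAdmissible Z (c.comp a.toPath)) :
    ∃ q : Path y x, c = a.toPath.comp q ∧ IsPrimitiveCycle Z (q.comp a.toPath) := by
  have h1 := hc.head?_eq hsp (p := a.toPath) (by simp) h
  obtain ⟨q, rfl⟩ := exists_toPath_comp_of_head?_arrows h1
  exact ⟨q, rfl, hc.rotate hsp⟩

theorem IsPrimitiveCycle.exists_toPath_comp (hsp : IsSpecialPair Z) {x y : V} {a : x ⟶ y}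
    {c : Path y y} (hc : IsPrimitiveCycle Z c) (h : IsZAdmissible Z (a.toPath.comp c)) :
    ∃ q : Path y x, c = q.comp a.toPath ∧ IsPrimitiveCycle Z (a.toPath.comp q) := by
  obtain ⟨b, hb⟩ := c.exists_head?_arrows hc.nontrivial
  have h1 : Follows Z ⟨x, y, a⟩ b := by
    have := h.isChain
    rw [arrows_comp, List.isChain_append] at this
    exact this.2.2 _ (by simp) _ hb
  obtain ⟨w, q, e, rfl⟩ := c.length_ne_zero_iff_eq_cons.mp hc.nontrivial.ne'
  have h2 : Follows Z ⟨w, y, e⟩ b := by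
    have := hc.powersAdmissible.comp_self.isChain
    rw [arrows_comp, List.isChain_append] at this
    exact this.2.2 _ (by simp) _ hb
  have h3 := h1.left_unique hsp h2
  cases h3
  exact ⟨q, rfl, IsPrimitiveCycle.rotate hsp (r := q) (q := a.toPath) hc⟩

/-! ### Long admissible paths -/

theorem isPeriodicPt_of_follows (hsp : IsSpecialPair Z) [Finite (TotalArrow V)]
    {b : TotalArrow V} (h : ∀ i : ℕ, Follows Z ((nextArrow Z)^[i] b) ((nextArrow Z)^[i + 1] b)) :
    b ∈ Function.periodicPts (nextArrow Z) := by
  obtain ⟨i, j, hij, heq⟩ := Finite.exists_ne_map_eq_of_infinite fun i => (nextArrow Z)^[i] b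
  wlog hlt : i < j generalizing i j
  · exact this j i hij.symm heq.symm (by omega)
  clear hij
  induction i generalizing j with
  | zero => exact ⟨j, hlt, heq.symm⟩
  | succ i ih =>
    obtain ⟨j, rfl⟩ := Nat.exists_eq_succ_of_ne_zero (by omega : j ≠ 0)
    refine ih j ?_ (by omega)
    -- Uniqueness of predecessors lets a coincidence of iterates be pulled back one step at a time,
    -- so the orbit is periodic from the start and not only eventually.
    have h1 := h i
    rw [heq] at h1
    exact h1.left_unique hsp (h j)

theorem exists_isPrimitiveCycle_of_unbounded (hsp : IsSpecialPair Z) [Finite (TotalArrow V)]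
    {b : TotalArrow V} {x : V}
    (h : ∀ n : ℕ, ∃ (y : V) (p : Path x y), IsZAdmissible Z p ∧ n < p.length ∧
      p.arrows.head? = some b) :
    ∃ c : Path x x, IsPrimitiveCycle Z c ∧ c.arrows.head? = some b := by
  have hper : b ∈ Function.periodicPts (nextArrow Z) := by
    refine isPeriodicPt_of_follows hsp fun i => ?_
    obtain ⟨y, p, hp, hl, hb⟩ := h (i + 1)
    have h1 := hp.isChain
    rw [hp.arrows_eq_iterate hsp hb, List.isChain_iff_getElem] at h1
    have h2 := h1 i (by simpa using hl)
    rwa [List.getElem_iterate, List.getElem_iterate] at h2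
  set t := Function.minimalPeriod (nextArrow Z) b with ht
  have ht0 : 0 < t := Function.minimalPeriod_pos_of_mem_periodicPts hper
  have htp : Function.IsPeriodicPt (nextArrow Z) t b := Function.isPeriodicPt_minimalPeriod _ _
  obtain ⟨y, p, hp, hl, hb⟩ := h t
  obtain ⟨c, e, rfl, hc⟩ := exists_cycle_eq_comp hsp hp hb ht0 hl htp
  have hc0 : 0 < c.length := hc ▸ ht0
  rw [head?_arrows_comp e hc0] at hb
  refine ⟨c, isPrimitiveCycle_of_length_eq hsp hc0 ?_ hb (hc.trans ht), hb⟩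
  -- The `n`-th power of `c` is an initial segment of an admissible path of length more than `n *
  -- c.length` starting with `b`.
  intro n hn
  obtain ⟨z, q, hq, hl, hqb⟩ := h (n * c.length)
  obtain ⟨w, d, r, rfl, hd⟩ := q.exists_eq_comp_of_le_length hl.le
  have hd0 : 0 < d.length := hd ▸ Nat.mul_pos hn hc0
  rw [head?_arrows_comp r hd0] at hqb
  have heq : (⟨x, w, d⟩ : QPath V) = ⟨x, x, cyclePow c n⟩ := by
    apply mk_eq_of_arrows_eq
    rw [arrows_cyclePow (hp.of_comp_left.arrows_eq_iterate hsp hb) (hc.symm ▸ htp),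
      hq.of_comp_left.arrows_eq_iterate hsp hqb, hd]
  cases heq
  exact hq.of_comp_left

/-- Sufficiently long admissible paths begin with a primitive cycle. -/
theorem exists_bound_eq_comp (hsp : IsSpecialPair Z) [Finite (TotalArrow V)] :
    ∃ h : ℕ, ∀ (x y : V) (p : Path x y), IsZAdmissible Z p → h < p.length →
      ∃ (c : Path x x) (q : Path x y), IsPrimitiveCycle Z c ∧ 0 < q.length ∧ p = c.comp q := by
  have key : ∀ b : TotalArrow V, ∃ h : ℕ, ∀ (y : V) (p : Path b.1 y), IsZAdmissible Z p →
      p.arrows.head? = some b → h < p.length →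
      ∃ (c : Path b.1 b.1) (q : Path b.1 y), IsPrimitiveCycle Z c ∧ 0 < q.length ∧
        p = c.comp q := by
    intro b
    -- If a primitive cycle starts with `b`, its length serves as the bound; otherwise the
    -- admissible paths starting with `b` have bounded length, and beyond that bound nothing is to
    -- be shown.
    by_cases hb : ∃ c : Path b.1 b.1, IsPrimitiveCycle Z c ∧ c.arrows.head? = some b
    · obtain ⟨c, hc, hcb⟩ := hb
      refine ⟨c.length, fun y p hp hpb hl => ?_⟩
      obtain ⟨q, rfl⟩ := hc.isZAdmissible.exists_eq_comp hsp hp hc.nontrivial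
        (hcb.trans hpb.symm) hl.le
      refine ⟨c, q, hc, ?_, rfl⟩
      rw [length_comp] at hl
      omega
    · by_contra! hcon
      refine hb (exists_isPrimitiveCycle_of_unbounded hsp fun n => ?_)
      obtain ⟨y, p, hp, hpb, hl, -⟩ := hcon n
      exact ⟨y, p, hp, hl, hpb⟩
  choose h hh using key
  obtain ⟨m, hm⟩ := (Set.finite_range h).bddAbove
  refine ⟨m, fun x y p hp hl => ?_⟩
  obtain ⟨b, hb⟩ := p.exists_head?_arrows (by omega)
  obtain rfl := fst_of_head?_arrows hb
  exact hh b y p hp hb ((hm (Set.mem_range_self b)).trans_lt hl)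

end Admissible

/-! ### The primitive-nerve partition -/

section Nerve

open Quiver Quiver.Path

variable {V : Type u} [Quiver.{v} V] {Z : Set (QPath V)} {n : ℕ} {P : Fin n → Set V}

theorem PrimRel.symm {x y : V} (h : PrimRel Z x y) : PrimRel Z y x := by
  obtain ⟨z, c, hc, hx, hy⟩ := h
  exact ⟨z, c, hc, hy, hx⟩

theorem IsPrimitiveNervePartition.mem_iff_of_primRel (hP : IsPrimitiveNervePartition Z P)
    {x y : V} (h : PrimRel Z x y) (i : Fin n) : x ∈ P i ↔ y ∈ P i := by
  obtain ⟨w, -, hw⟩ : P i ∈ nerveParts Z := hP.range_eq ▸ Set.mem_range_self i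
  rw [hw]
  exact ⟨fun hx => Relation.TransGen.tail hx h, fun hy => Relation.TransGen.tail hy h.symm⟩

/-- The transitive closure is symmetric, so two classes sharing a vertex coincide as sets;
injectivity of the listing then identifies the indices. -/
theorem IsPrimitiveNervePartition.eq_of_mem (hP : IsPrimitiveNervePartition Z P)
    {x : V} {i j : Fin n} (hi : x ∈ P i) (hj : x ∈ P j) : i = j := by
  have hsymm : ∀ {a b : V}, Relation.TransGen (PrimRel Z) a b →
      Relation.TransGen (PrimRel Z) b a := by
    intro a b h
    have : Std.Symm (PrimRel Z) := ⟨fun _ _ h => PrimRel.symm h⟩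
    exact symm h
  apply hP.injective
  obtain ⟨v, -, hv⟩ : P i ∈ nerveParts Z := hP.range_eq ▸ Set.mem_range_self i
  obtain ⟨w, -, hw⟩ : P j ∈ nerveParts Z := hP.range_eq ▸ Set.mem_range_self j
  rw [hv] at hi ⊢
  rw [hw] at hj ⊢
  ext y
  exact ⟨fun hy => hj.trans ((hsymm hi).trans hy), fun hy => hi.trans ((hsymm hj).trans hy)⟩

theorem IsPrimitiveNervePartition.exists_mem (hP : IsPrimitiveNervePartition Z P)
    {x : V} {c : Path x x} (hc : IsPrimitiveCycle Z c) : ∃ i, x ∈ P i := by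
  have hx : PrimRel Z x x := ⟨x, c, hc, start_mem_vertices c, start_mem_vertices c⟩
  have : {y | Relation.TransGen (PrimRel Z) x y} ∈ Set.range P :=
    hP.range_eq ▸ ⟨x, ⟨x, c, hc, start_mem_vertices c⟩, rfl⟩
  obtain ⟨i, hi⟩ := this
  exact ⟨i, hi ▸ Relation.TransGen.single hx⟩

theorem IsPrimitiveNervePartition.mem_iff_of_comp (hP : IsPrimitiveNervePartition Z P)
    {x y : V} {q : Path y x} {r : Path x y} (hc : IsPrimitiveCycle Z (r.comp q)) (i : Fin n) :
    x ∈ P i ↔ y ∈ P i := by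
  refine hP.mem_iff_of_primRel ⟨x, _, hc, start_mem_vertices _, ?_⟩ i
  rw [vertices_comp]
  exact List.mem_append_right _ (start_mem_vertices q)

end Nerve

/-! ### Regular sequences -/

section Regular

variable {R : Type w} [CommRing R]

/-- The ideal generated by the entries of `s` other than the `i`-th. -/
def Ideal.spanOthers {n : ℕ} (s : Fin n → R) (i : Fin n) : Ideal R := Ideal.span (s '' {i}ᶜ)

theorem Ideal.mem_spanOthers {n : ℕ} (s : Fin n → R) {i j : Fin n} (h : j ≠ i) :
    s j ∈ Ideal.spanOthers s i := Ideal.subset_span ⟨j, h, rfl⟩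

open RingTheory.Sequence in
theorem Ideal.mem_spanOthers_of_mul_mem [IsLocalRing R] [IsNoetherianRing R] {n : ℕ}
    {s : Fin n → R} (hreg : IsRegular R (List.ofFn s)) {i : Fin n} {r : R}
    (h : r * s i ∈ Ideal.spanOthers s i) : r ∈ Ideal.spanOthers s i := by
  classical
  set l := ((List.finRange n).erase i).map s with hl
  -- Regular sequences over a noetherian local ring may be permuted, so `s i` may be placed last,
  -- where regularity says that it is a nonzerodivisor modulo the others.
  have hperm : (List.ofFn s).Perm (l ++ [s i]) := by
    rw [List.ofFn_eq_map, hl]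
    have h1 := (List.perm_cons_erase (List.mem_finRange i)).map s
    exact h1.trans (List.perm_append_singleton _ _).symm
  have h1 := ((IsLocalRing.isRegular_of_perm hreg hperm).toIsWeaklyRegular)
  rw [isWeaklyRegular_append_iff, isWeaklyRegular_singleton_iff] at h1
  have hI : Ideal.ofList l = Ideal.spanOthers s i := by
    rw [Ideal.ofList, Ideal.spanOthers]
    congr 1
    ext y
    simp only [hl, List.mem_map, Set.mem_ofPred_eq, Set.mem_image, Set.mem_compl_iff,
      Set.mem_singleton_iff, (List.nodup_finRange n).mem_erase_iff, List.mem_finRange, and_true]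
  have h2 := h1.2
  rw [hI, isSMulRegular_quotient_iff_mem_of_smul_mem] at h2
  have h3 := h2 r
  simp only [smul_eq_mul, Ideal.mul_top] at h3
  exact h3 (by rwa [mul_comm])

theorem Ideal.pow_notMem_spanOthers [IsLocalRing R] [IsNoetherianRing R] {n : ℕ}
    {s : Fin n → R} (hreg : RingTheory.Sequence.IsRegular R (List.ofFn s))
    (hs : ∀ j, s j ∈ IsLocalRing.maximalIdeal R) (i : Fin n) (k : ℕ) :
    s i ^ k ∉ Ideal.spanOthers s i := by
  induction k with
  | zero =>
    intro h
    have hle : Ideal.spanOthers s i ≤ IsLocalRing.maximalIdeal R := by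
      refine Ideal.span_le.mpr ?_
      rintro _ ⟨j, -, rfl⟩
      exact hs j
    rw [pow_zero] at h
    exact (IsLocalRing.maximalIdeal.isMaximal R).ne_top
      ((Ideal.eq_top_iff_one _).mpr (hle h))
  | succ k ih => exact fun h => ih (Ideal.mem_spanOthers_of_mul_mem hreg (by rwa [← pow_succ]))

end Regular

/-! ### Paths in the path algebra -/

section Algebra

open Quiver Quiver.Path

variable {R : Type w} [CommRing R] {V : Type u} [Quiver.{v} V]

namespace PathAlgebra

theorem coord_ofPath_self (p : QPath V) : (basis R).coord p (ofPath R p) = 1 := by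
  simp [ofPath]

theorem coord_ofPath_of_ne {p q : QPath V} (h : q ≠ p) :
    (basis R).coord p (ofPath R q) = 0 := by
  simp [ofPath, h]

theorem ofPath_mem_arrowIdeal {p : QPath V} (h : 0 < p.length) :
    ofPath R p ∈ arrowIdeal R V :=
  Submodule.mem_iSup_of_mem p.length (Submodule.mem_iSup_of_mem (p := fun _ => lengthSpan R V _)
    (show 1 ≤ p.length from h) (Submodule.subset_span ⟨p, rfl, rfl⟩))

theorem arrowIdeal_le {X : Submodule R (PathAlgebra R V)}
    (h : ∀ p : QPath V, 0 < p.length → ofPath R p ∈ X) : arrowIdeal R V ≤ X := by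
  refine iSup₂_le fun l hl => Submodule.span_le.mpr ?_
  rintro _ ⟨p, rfl, rfl⟩
  exact h p hl

theorem coord_triv_of_mem_arrowIdeal {u : PathAlgebra R V} (h : u ∈ arrowIdeal R V) (x : V) :
    (basis R).coord (QPath.triv x) u = 0 := by
  have : arrowIdeal R V ≤ LinearMap.ker ((basis R).coord (QPath.triv x)) := by
    refine arrowIdeal_le fun p hp => ?_
    refine coord_ofPath_of_ne ?_
    rintro rfl
    simp [QPath.length, QPath.triv] at hp
  exact this h

theorem coord_mem_of_mem_coeffIdeal {𝔞 : Ideal R} {u : PathAlgebra R V} (h : u ∈ coeffIdeal 𝔞 V)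
    (p : QPath V) : (basis R).coord p u ∈ 𝔞 := h p

theorem smul_mem_coeffIdeal {𝔞 : Ideal R} {r : R} (h : r ∈ 𝔞) (u : PathAlgebra R V) :
    r • u ∈ coeffIdeal 𝔞 V := by
  intro q
  rw [map_smul, Finsupp.smul_apply]
  exact 𝔞.mul_mem_right _ h

open Classical in
/-- The projection onto the span of the paths that satisfy a predicate. -/
noncomputable def proj (R : Type w) [CommRing R] (S : QPath V → Prop) :
    PathAlgebra R V →ₗ[R] PathAlgebra R V :=
  (basis R).constr R fun p => if S p then ofPath R p else 0

theorem proj_ofPath_of_pos {S : QPath V → Prop} {p : QPath V} (h : S p) :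
    proj R S (ofPath R p) = ofPath R p := by
  rw [proj, ofPath, Module.Basis.constr_basis, if_pos h]
  rfl

theorem proj_ofPath_of_neg {S : QPath V → Prop} {p : QPath V} (h : ¬ S p) :
    proj R S (ofPath R p) = 0 := by
  rw [proj, ofPath, Module.Basis.constr_basis, if_neg h]

variable [Fintype V]

theorem ofPath_mul_ofPath {x y z : V} (q : Path y z) (p : Path x y) :
    ofPath R ⟨y, z, q⟩ * ofPath R ⟨x, y, p⟩ = ofPath R ⟨x, z, p.comp q⟩ := by
  change mulLin R _ _ = _
  rw [mulLin_ofPath, pathMul, dif_pos rfl]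
  simp [QPath.comp]

theorem ofPath_mul_ofPath_of_ne {x y z w : V} (q : Path y z) (p : Path x w) (h : w ≠ y) :
    ofPath R ⟨y, z, q⟩ * ofPath R ⟨x, w, p⟩ = 0 := by
  change mulLin R _ _ = _
  rw [mulLin_ofPath, pathMul, dif_neg h]

theorem ofPath_mul_e {x y : V} (p : Path x y) :
    ofPath R ⟨x, y, p⟩ * e R x = ofPath R ⟨x, y, p⟩ := by
  rw [e, QPath.triv, ofPath_mul_ofPath, nil_comp]

theorem e_mul_ofPath {x y : V} (p : Path x y) :
    e R y * ofPath R ⟨x, y, p⟩ = ofPath R ⟨x, y, p⟩ := by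
  rw [e, QPath.triv, ofPath_mul_ofPath, comp_nil]

theorem ofPath_mem_arrowIdeal_sq {x y : V} {p : Path x y} (h : 2 ≤ p.length) :
    ofPath R ⟨x, y, p⟩ ∈ arrowIdeal R V ^ 2 := by
  cases p with
  | nil => simp at h
  | cons p a =>
    rw [← comp_toPath_eq_cons, ← ofPath_mul_ofPath, pow_two]
    refine Submodule.mul_mem_mul (ofPath_mem_arrowIdeal ?_) (ofPath_mem_arrowIdeal ?_)
    · simp [QPath.length]
    · simp only [length_cons] at h
      simp only [QPath.length]
      omega

theorem arrowIdeal_pow_le (m : ℕ) :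
    arrowIdeal R V ^ m ≤ Submodule.span R {u | ∃ p : QPath V, m ≤ p.length ∧ u = ofPath R p} := by
  induction m with
  | zero =>
    intro u hu
    -- Every path has length at least zero, so the target is all of the path algebra.
    clear hu
    induction u using induction_linear with
    | zero => exact Submodule.zero_mem _
    | add u w hu hw => exact Submodule.add_mem _ hu hw
    | smul r p => exact Submodule.smul_mem _ _ (Submodule.subset_span ⟨p, Nat.zero_le _, rfl⟩)
  | succ m ih =>
    have h1 : arrowIdeal R V ≤ Submodule.span R {u | ∃ p : QPath V, 1 ≤ p.length ∧
        u = ofPath R p} := arrowIdeal_le fun p hp => Submodule.subset_span ⟨p, hp, rfl⟩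
    rw [pow_succ]
    refine (mul_le_mul' ih h1).trans ?_
    rw [Submodule.span_mul_span, Submodule.span_le]
    rintro _ ⟨_, ⟨⟨y, z, q⟩, hq, rfl⟩, _, ⟨⟨x, w, p⟩, hp, rfl⟩, rfl⟩
    dsimp only
    by_cases h : w = y
    · subst h
      rw [ofPath_mul_ofPath]
      refine Submodule.subset_span ⟨_, ?_, rfl⟩
      simp only [QPath.length, length_comp] at hp hq ⊢
      omega
    · rw [ofPath_mul_ofPath_of_ne _ _ h]
      exact Submodule.zero_mem _

end PathAlgebra

end Algebra

/-! ### Relations modulo the non-admissible paths -/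

section Relations

open Quiver Quiver.Path PathAlgebra

variable {R : Type w} [CommRing R] {V : Type u} [Quiver.{v} V]

/-- The span of the paths that are not `Z`-admissible. -/
noncomputable def nonadmissibleSpan (R : Type w) [CommRing R] (Z : Set (QPath V)) :
    Submodule R (PathAlgebra R V) :=
  Submodule.span R {u | ∃ (x y : V) (p : Path x y), ¬ IsZAdmissible Z p ∧ u = ofPath R ⟨x, y, p⟩}

open Classical in
/-- The element `r e_x - σ_x` if `x ∈ S`, and `r e_x` otherwise. -/
noncomputable def relator (Z : Set (QPath V)) (S : Set V) (r : R) (x : V) : PathAlgebra R V :=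
  r • e R x - if x ∈ S then sigma R Z x else 0

variable {Z : Set (QPath V)}

theorem relator_of_mem {S : Set V} {r : R} {x : V} (h : x ∈ S) :
    relator Z S r x = r • e R x - sigma R Z x := by
  rw [relator, if_pos h]

theorem relator_of_notMem {S : Set V} {r : R} {x : V} (h : x ∉ S) :
    relator Z S r x = r • e R x := by
  rw [relator, if_neg h, sub_zero]

theorem ofPath_mem_nonadmissibleSpan {x y : V} {p : Path x y} (h : ¬ IsZAdmissible Z p) :
    ofPath R ⟨x, y, p⟩ ∈ nonadmissibleSpan R Z :=
  Submodule.subset_span ⟨x, y, p, h, rfl⟩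

theorem exists_sigma_eq_sum [Finite (TotalArrow V)] (hsp : IsSpecialPair Z) (x : V) :
    ∃ T : Finset (Path x x), (∀ c, c ∈ T ↔ IsPrimitiveCycle Z c) ∧
      sigma R Z x = ∑ c ∈ T, ofPath R ⟨x, x, c⟩ :=
  ⟨(finite_setOf_isPrimitiveCycle hsp x).toFinset, fun c => by simp,
    finsum_mem_eq_finite_toFinset_sum _ _⟩

theorem sigma_mem_arrowIdeal [Finite (TotalArrow V)] (hsp : IsSpecialPair Z) (x : V) :
    sigma R Z x ∈ arrowIdeal R V := by
  obtain ⟨T, hT, h⟩ := exists_sigma_eq_sum (R := R) hsp x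
  rw [h]
  exact Submodule.sum_mem _ fun c hc => ofPath_mem_arrowIdeal ((hT c).mp hc).nontrivial

variable [Fintype V]

theorem mul_mem_nonadmissibleSpan_left (w : PathAlgebra R V) {u : PathAlgebra R V}
    (hu : u ∈ nonadmissibleSpan R Z) : w * u ∈ nonadmissibleSpan R Z := by
  induction hu using Submodule.span_induction with
  | zero => simp
  | add u u' _ _ hu hu' => rw [mul_add]; exact add_mem hu hu'
  | smul r u _ hu => rw [mul_smul_comm]; exact Submodule.smul_mem _ _ hu
  | mem u hu =>
    obtain ⟨x, y, p, hp, rfl⟩ := hu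
    induction w using PathAlgebra.induction_linear with
    | zero => simp
    | add w w' hw hw' => rw [add_mul]; exact add_mem hw hw'
    | smul r q =>
      obtain ⟨z, z', q⟩ := q
      rw [smul_mul_assoc]
      refine Submodule.smul_mem _ _ ?_
      by_cases h : y = z
      · subst h
        rw [ofPath_mul_ofPath]
        exact ofPath_mem_nonadmissibleSpan fun h => hp h.of_comp_left
      · rw [ofPath_mul_ofPath_of_ne _ _ h]
        exact zero_mem _

theorem mul_mem_nonadmissibleSpan_right (w : PathAlgebra R V) {u : PathAlgebra R V}
    (hu : u ∈ nonadmissibleSpan R Z) : u * w ∈ nonadmissibleSpan R Z := by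
  induction hu using Submodule.span_induction with
  | zero => simp
  | add u u' _ _ hu hu' => rw [add_mul]; exact add_mem hu hu'
  | smul r u _ hu => rw [smul_mul_assoc]; exact Submodule.smul_mem _ _ hu
  | mem u hu =>
    obtain ⟨x, y, p, hp, rfl⟩ := hu
    induction w using PathAlgebra.induction_linear with
    | zero => simp
    | add w w' hw hw' => rw [mul_add]; exact add_mem hw hw'
    | smul r q =>
      obtain ⟨z, z', q⟩ := q
      rw [mul_smul_comm]
      refine Submodule.smul_mem _ _ ?_
      by_cases h : z' = x
      · subst h
        rw [ofPath_mul_ofPath]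
        exact ofPath_mem_nonadmissibleSpan fun h => hp h.of_comp_right
      · rw [ofPath_mul_ofPath_of_ne _ _ h]
        exact zero_mem _

variable [Finite (TotalArrow V)]

theorem e_mul_sigma (hsp : IsSpecialPair Z) (x : V) : e R x * sigma R Z x = sigma R Z x := by
  obtain ⟨T, -, h⟩ := exists_sigma_eq_sum (R := R) hsp x
  simp only [h, Finset.mul_sum, e_mul_ofPath]

theorem sigma_mul_e (hsp : IsSpecialPair Z) (x : V) : sigma R Z x * e R x = sigma R Z x := by
  obtain ⟨T, -, h⟩ := exists_sigma_eq_sum (R := R) hsp x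
  simp only [h, Finset.sum_mul, ofPath_mul_e]

theorem e_mul_relator (hsp : IsSpecialPair Z) (S : Set V) (r : R) (x : V) :
    e R x * relator Z S r x = relator Z S r x := by
  have h : e R x * e R x = e R x := ofPath_mul_e _
  by_cases hx : x ∈ S
  · rw [relator_of_mem hx, mul_sub, mul_smul_comm, h, e_mul_sigma hsp]
  · rw [relator_of_notMem hx, mul_smul_comm, h]

theorem relator_mul_e (hsp : IsSpecialPair Z) (S : Set V) (r : R) (x : V) :
    relator Z S r x * e R x = relator Z S r x := by
  have h : e R x * e R x = e R x := ofPath_mul_e _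
  by_cases hx : x ∈ S
  · rw [relator_of_mem hx, sub_mul, smul_mul_assoc, h, sigma_mul_e hsp]
  · rw [relator_of_notMem hx, smul_mul_assoc, h]

theorem ofPath_mul_sigma_mem (hsp : IsSpecialPair Z) {x y : V} {p : Path x y}
    (h : ∀ c : Path x x, IsPrimitiveCycle Z c → ¬ IsZAdmissible Z (c.comp p)) :
    ofPath R ⟨x, y, p⟩ * sigma R Z x ∈ nonadmissibleSpan R Z := by
  obtain ⟨T, hT, hs⟩ := exists_sigma_eq_sum (R := R) hsp x
  simp only [hs, Finset.mul_sum, ofPath_mul_ofPath]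
  exact Submodule.sum_mem _ fun c hc => ofPath_mem_nonadmissibleSpan (h c ((hT c).mp hc))

/-- Of all the summands of `σ_x` only `c` can admissibly precede `p`; here `p` must be nontrivial.
-/
theorem ofPath_mul_sigma_sub_mem (hsp : IsSpecialPair Z) {x y : V} {p : Path x y}
    (hp : 0 < p.length) {c : Path x x} (hc : IsPrimitiveCycle Z c)
    (h : IsZAdmissible Z (c.comp p)) :
    ofPath R ⟨x, y, p⟩ * sigma R Z x - ofPath R ⟨x, y, c.comp p⟩ ∈ nonadmissibleSpan R Z := by
  classical
  obtain ⟨T, hT, hs⟩ := exists_sigma_eq_sum (R := R) hsp x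
  simp only [hs, Finset.mul_sum, ofPath_mul_ofPath]
  rw [← Finset.add_sum_erase _ _ ((hT c).mpr hc), add_sub_cancel_left]
  refine Submodule.sum_mem _ fun d hd => ofPath_mem_nonadmissibleSpan fun h' => ?_
  rw [Finset.mem_erase, hT] at hd
  exact hd.1 (hd.2.eq_of_comp hsp hc hp h' h)

theorem sigma_mul_arrow_mem (hsp : IsSpecialPair Z) {x y : V} {a : x ⟶ y}
    (h : ∀ c : Path y y, IsPrimitiveCycle Z c → ¬ IsZAdmissible Z (a.toPath.comp c)) :
    sigma R Z y * ofPath R ⟨x, y, a.toPath⟩ ∈ nonadmissibleSpan R Z := by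
  obtain ⟨T, hT, hs⟩ := exists_sigma_eq_sum (R := R) hsp y
  simp only [hs, Finset.sum_mul, ofPath_mul_ofPath]
  exact Submodule.sum_mem _ fun c hc => ofPath_mem_nonadmissibleSpan (h c ((hT c).mp hc))

theorem sigma_mul_arrow_sub_mem (hsp : IsSpecialPair Z) {x y : V} {a : x ⟶ y} {c : Path y y}
    (hc : IsPrimitiveCycle Z c) (h : IsZAdmissible Z (a.toPath.comp c)) :
    sigma R Z y * ofPath R ⟨x, y, a.toPath⟩ - ofPath R ⟨x, y, a.toPath.comp c⟩ ∈
      nonadmissibleSpan R Z := by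
  classical
  obtain ⟨T, hT, hs⟩ := exists_sigma_eq_sum (R := R) hsp y
  simp only [hs, Finset.sum_mul, ofPath_mul_ofPath]
  rw [← Finset.add_sum_erase _ _ ((hT c).mpr hc), add_sub_cancel_left]
  refine Submodule.sum_mem _ fun d hd => ofPath_mem_nonadmissibleSpan fun h' => ?_
  rw [Finset.mem_erase, hT] at hd
  obtain ⟨q, rfl, hq⟩ := hc.exists_toPath_comp hsp h
  obtain ⟨q', rfl, hq'⟩ := hd.2.exists_toPath_comp hsp h'
  -- Both cycles end in `a`. Their rotations starting with `a` are primitive with the same first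
  -- arrow, hence equal.
  refine hd.1 (congrArg (fun q => comp q a.toPath) ?_)
  have h1 := hq.eq hsp hq' (by rw [head?_arrows_comp _ (by simp), head?_arrows_comp _ (by simp)])
  exact (comp_injective_right _ h1).symm

/-- The elements `r e_x - σ_x` commute with the arrows modulo the non-admissible paths. -/
theorem relator_mul_arrow_sub_mem (hsp : IsSpecialPair Z) {S : Set V}
    (hS : ∀ (x y : V) (p : Path x y) (q : Path y x), IsPrimitiveCycle Z (p.comp q) →
      (x ∈ S ↔ y ∈ S)) (r : R) {x y : V} (a : x ⟶ y) :
    relator Z S r y * ofPath R ⟨x, y, a.toPath⟩ - ofPath R ⟨x, y, a.toPath⟩ * relator Z S r x ∈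
      nonadmissibleSpan R Z := by
  -- If a primitive cycle `a q` starts with `a`, both `a σ_x` and `σ_y a` reduce to the path `a q
  -- a`, and `x`, `y` are both in `S` or both outside. Otherwise both products vanish modulo
  -- non-admissible paths, and membership in `S` is irrelevant.
  by_cases h : ∃ q : Path y x, IsPrimitiveCycle Z (a.toPath.comp q)
  · obtain ⟨q, hq⟩ := h
    have hq' := hq.rotate hsp
    have hxy := hS x y _ _ hq
    have hadm : IsZAdmissible Z ((a.toPath.comp q).comp a.toPath) :=
      hq.comp_isZAdmissible hsp (by simp) hq.isZAdmissible.of_comp_left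
        (by rw [head?_arrows_comp _ (by simp)])
    have h1 := ofPath_mul_sigma_sub_mem (R := R) hsp (p := a.toPath) (by simp) hq hadm
    have h2 := sigma_mul_arrow_sub_mem (R := R) hsp (a := a) hq' (by rwa [← comp_assoc])
    by_cases hx : x ∈ S
    · rw [relator_of_mem hx, relator_of_mem (hxy.mp hx), sub_mul, mul_sub, smul_mul_assoc,
        mul_smul_comm, e_mul_ofPath, ofPath_mul_e]
      convert sub_mem h1 h2 using 1
      rw [comp_assoc]
      abel
    · rw [relator_of_notMem hx, relator_of_notMem (fun hy => hx (hxy.mpr hy)), smul_mul_assoc,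
        mul_smul_comm, e_mul_ofPath, ofPath_mul_e, sub_self]
      exact zero_mem _
  · have h1 := ofPath_mul_sigma_mem (R := R) hsp (p := a.toPath) fun c hc hadm => by
      obtain ⟨q, rfl, -⟩ := hc.exists_comp_toPath hsp hadm
      exact h ⟨q, hc⟩
    have h2 := sigma_mul_arrow_mem (R := R) hsp (a := a) fun c hc hadm => by
      obtain ⟨q, -, hq⟩ := hc.exists_toPath_comp hsp hadm
      exact h ⟨q, hq⟩
    by_cases hx : x ∈ S <;> by_cases hy : y ∈ S <;>
      simp only [relator_of_mem, relator_of_notMem, hx, hy, not_false_eq_true, sub_mul, mul_sub,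
        smul_mul_assoc, mul_smul_comm, e_mul_ofPath, ofPath_mul_e, sub_self, zero_mem]
    · convert sub_mem h1 h2 using 1
      abel
    · convert h1 using 1
      abel
    · convert neg_mem h2 using 1
      abel

theorem relator_mul_ofPath_sub_mem (hsp : IsSpecialPair Z) {S : Set V}
    (hS : ∀ (x y : V) (p : Path x y) (q : Path y x), IsPrimitiveCycle Z (p.comp q) →
      (x ∈ S ↔ y ∈ S)) (r : R) {x y : V} (p : Path x y) :
    relator Z S r y * ofPath R ⟨x, y, p⟩ - ofPath R ⟨x, y, p⟩ * relator Z S r x ∈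
      nonadmissibleSpan R Z := by
  induction p with
  | nil =>
    have h1 := relator_mul_e (R := R) hsp S r x
    have h2 := e_mul_relator (R := R) hsp S r x
    rw [e, QPath.triv] at h1 h2
    rw [h1, h2, sub_self]
    exact zero_mem _
  | cons p a ih =>
    rw [← comp_toPath_eq_cons, ← ofPath_mul_ofPath]
    have h1 := mul_mem_nonadmissibleSpan_right (ofPath R ⟨_, _, p⟩)
      (relator_mul_arrow_sub_mem hsp hS r a)
    have h2 := mul_mem_nonadmissibleSpan_left (ofPath R ⟨_, _, a.toPath⟩) ih
    convert add_mem h1 h2 using 1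
    simp only [mul_sub, sub_mul, mul_assoc]
    abel

end Relations

/-! ### The structure of the ideal -/

section StringIdeal

open Quiver Quiver.Path PathAlgebra

variable {R : Type w} [CommRing R] {V : Type u} [Quiver.{v} V]

/-- Relations between nontrivial paths with the same first arrow and the same last arrow, which
span the intersection of the ideal `stringIdeal Z P s` with `arrowIdeal R V`. -/
inductive IsPathRelation (Z : Set (QPath V)) {n : ℕ} (P : Fin n → Set V) (s : Fin n → R) :
    PathAlgebra R V → Prop
  | nonadmissible {x y : V} (p : Path x y) (h : ¬ IsZAdmissible Z p) :
      IsPathRelation Z P s (ofPath R ⟨x, y, p⟩)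
  | smul (i : Fin n) {x y : V} (p : Path x y) (hp : 0 < p.length)
      (h : x ∈ P i → ∀ c : Path x x, IsPrimitiveCycle Z c → ¬ IsZAdmissible Z (c.comp p)) :
      IsPathRelation Z P s (s i • ofPath R ⟨x, y, p⟩)
  | sub (i : Fin n) {x y : V} (p : Path x y) (hp : 0 < p.length) (hx : x ∈ P i)
      (c : Path x x) (hc : IsPrimitiveCycle Z c) (h : IsZAdmissible Z (c.comp p)) :
      IsPathRelation Z P s (s i • ofPath R ⟨x, y, p⟩ - ofPath R ⟨x, y, c.comp p⟩)

/-- The span of the relations between nontrivial paths. -/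
noncomputable def pathRelations (Z : Set (QPath V)) {n : ℕ} (P : Fin n → Set V) (s : Fin n → R) :
    Submodule R (PathAlgebra R V) :=
  Submodule.span R {u | IsPathRelation Z P s u}

variable {Z : Set (QPath V)} {n : ℕ} {P : Fin n → Set V} {s : Fin n → R}

theorem nonadmissibleSpan_le_pathRelations : nonadmissibleSpan R Z ≤ pathRelations Z P s := by
  refine Submodule.span_mono ?_
  rintro _ ⟨x, y, p, h, rfl⟩
  exact .nonadmissible p h

theorem pathRelations_le_arrowIdeal (hZ : ∀ z ∈ Z, 2 ≤ z.length) :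
    pathRelations Z P s ≤ arrowIdeal R V := by
  refine Submodule.span_le.mpr ?_
  rintro _ (⟨p, h⟩ | ⟨i, p, hp, -⟩ | ⟨i, p, hp, -, c, -, -⟩)
  · exact ofPath_mem_arrowIdeal (two_pos.trans_le (two_le_length_of_not_isZAdmissible hZ h))
  · exact Submodule.smul_mem _ _ (ofPath_mem_arrowIdeal hp)
  · refine sub_mem (Submodule.smul_mem _ _ (ofPath_mem_arrowIdeal hp)) (ofPath_mem_arrowIdeal ?_)
    simp only [QPath.length, length_comp]
    omega

/-- `pathRelations` is graded by any labelling of the paths that is invariant under composition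
with primitive cycles. -/
theorem proj_mem_pathRelations {S : QPath V → Prop}
    (hS : ∀ (x y : V) (p : Path x y) (c : Path x x), 0 < p.length → IsPrimitiveCycle Z c →
      IsZAdmissible Z (c.comp p) → (S ⟨x, y, c.comp p⟩ ↔ S ⟨x, y, p⟩))
    {u : PathAlgebra R V} (hu : u ∈ pathRelations Z P s) : proj R S u ∈ pathRelations Z P s := by
  have : pathRelations Z P s ≤ (pathRelations Z P s).comap (proj R S) := by
    refine Submodule.span_le.mpr fun u hu => ?_
    have hmem : u ∈ pathRelations Z P s := Submodule.subset_span hu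
    change proj R S u ∈ pathRelations Z P s
    obtain ⟨p, h⟩ | ⟨i, p, hp, h⟩ | ⟨i, p, hp, hx, c, hc, h⟩ := hu
    · by_cases hp : S ⟨_, _, p⟩
      · rwa [proj_ofPath_of_pos hp]
      · rw [proj_ofPath_of_neg hp]; exact zero_mem _
    · rw [map_smul]
      by_cases hp : S ⟨_, _, p⟩
      · rwa [proj_ofPath_of_pos hp]
      · rw [proj_ofPath_of_neg hp, smul_zero]; exact zero_mem _
    · have hiff := hS _ _ p c hp hc h
      rw [map_sub, map_smul]
      by_cases hp : S ⟨_, _, p⟩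
      · rwa [proj_ofPath_of_pos hp, proj_ofPath_of_pos (hiff.mpr hp)]
      · rw [proj_ofPath_of_neg hp, proj_ofPath_of_neg (fun h => hp (hiff.mp h)), smul_zero,
          sub_zero]
        exact zero_mem _
  exact this hu

/-- A vertex of `P i` lies in no other `P j`, so `s j` times any primitive cycle at `x` is a
monomial relation for `j ≠ i`. -/
theorem smul_sigma_mem_pathRelations [Finite (TotalArrow V)] (hsp : IsSpecialPair Z)
    (hP : IsPrimitiveNervePartition Z P) {i : Fin n} {x : V} (hx : x ∈ P i) {r : R}
    (hr : r ∈ Ideal.spanOthers s i) : r • sigma R Z x ∈ pathRelations Z P s := by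
  obtain ⟨T, hT, hs⟩ := exists_sigma_eq_sum (R := R) hsp x
  rw [hs]
  induction hr using Submodule.span_induction with
  | zero => rw [zero_smul]; exact zero_mem _
  | add r r' _ _ hr hr' => rw [add_smul]; exact add_mem hr hr'
  | smul t r _ hr => rw [smul_eq_mul, mul_smul]; exact Submodule.smul_mem _ _ hr
  | mem r hr =>
    obtain ⟨j, hj, rfl⟩ := hr
    rw [Finset.smul_sum]
    refine Submodule.sum_mem _ fun c hc => Submodule.subset_span
      (.smul j c ((hT c).mp hc).nontrivial fun hxj => ?_)
    exact absurd (hP.eq_of_mem hxj hx) hj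

variable [Fintype V]

theorem mem_idealSubmodule {I : TwoSidedIdeal (PathAlgebra R V)} {u : PathAlgebra R V} :
    u ∈ idealSubmodule I ↔ u ∈ I := by
  simp [idealSubmodule]

theorem relator_mem_stringIdeal (i : Fin n) (x : V) :
    relator Z (P i) (s i) x ∈ stringIdeal Z P s := by
  refine (le_sup_right : _ ≤ stringIdeal Z P s) ?_
  refine (le_iSup (fun i : Fin n =>
    (TwoSidedIdeal.span {y | ∃ x ∈ P i, y = s i • PathAlgebra.e R x - sigma R Z x} ⊔
        TwoSidedIdeal.span {y | ∃ x ∉ P i, y = s i • PathAlgebra.e R x})) i) ?_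
  by_cases hx : x ∈ P i
  · rw [relator_of_mem hx]
    exact TwoSidedIdeal.mem_sup_left (TwoSidedIdeal.subset_span ⟨x, hx, rfl⟩)
  · rw [relator_of_notMem hx]
    exact TwoSidedIdeal.mem_sup_right (TwoSidedIdeal.subset_span ⟨x, hx, rfl⟩)

theorem ofPath_mem_stringIdeal_of_mem {z : QPath V} (hz : z ∈ Z) :
    ofPath R z ∈ stringIdeal Z P s :=
  TwoSidedIdeal.mem_sup_left (TwoSidedIdeal.subset_span ⟨z, hz, rfl⟩)

theorem nonadmissibleSpan_le_stringIdeal :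
    nonadmissibleSpan R Z ≤ idealSubmodule (stringIdeal Z P s) := by
  refine Submodule.span_le.mpr ?_
  rintro _ ⟨x, y, p, h, rfl⟩
  obtain ⟨⟨t, u, z⟩, hz, a, b, rfl⟩ := not_not.mp h
  change _ ∈ idealSubmodule _
  rw [mem_idealSubmodule, ← ofPath_mul_ofPath, ← ofPath_mul_ofPath]
  exact TwoSidedIdeal.mul_mem_left _ _ _
    (TwoSidedIdeal.mul_mem_right _ _ _ (ofPath_mem_stringIdeal_of_mem hz))

/-- The span of the left multiples of the elements `relator Z (P i) (s i) x` and of the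
non-admissible paths. -/
noncomputable def relatorSpan (Z : Set (QPath V)) (P : Fin n → Set V) (s : Fin n → R) :
    Submodule R (PathAlgebra R V) :=
  nonadmissibleSpan R Z ⊔ Submodule.span R
    {u | ∃ (i : Fin n) (x : V) (w : PathAlgebra R V), u = w * relator Z (P i) (s i) x}

theorem mul_mem_relatorSpan_left (w : PathAlgebra R V) {u : PathAlgebra R V}
    (hu : u ∈ relatorSpan Z P s) : w * u ∈ relatorSpan Z P s := by
  obtain ⟨a, ha, b, hb, rfl⟩ := Submodule.mem_sup.mp hu
  rw [mul_add]
  refine add_mem (Submodule.mem_sup_left (mul_mem_nonadmissibleSpan_left w ha)) ?_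
  clear hu ha
  induction hb using Submodule.span_induction with
  | zero => rw [mul_zero]; exact zero_mem _
  | add u u' _ _ hu hu' => rw [mul_add]; exact add_mem hu hu'
  | smul r u _ hu => rw [mul_smul_comm]; exact Submodule.smul_mem _ _ hu
  | mem u hu =>
    obtain ⟨i, x, w', rfl⟩ := hu
    exact Submodule.mem_sup_right (Submodule.subset_span ⟨i, x, w * w', (mul_assoc _ _ _).symm⟩)

variable [Finite (TotalArrow V)]

theorem pathRelations_le_stringIdeal (hsp : IsSpecialPair Z) :
    pathRelations Z P s ≤ idealSubmodule (stringIdeal Z P s) := by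
  have hrel : ∀ (i : Fin n) {x y : V} (p : Path x y),
      ofPath R ⟨x, y, p⟩ * relator Z (P i) (s i) x ∈ idealSubmodule (stringIdeal Z P s) :=
    fun i x y p => mem_idealSubmodule.mpr
      (TwoSidedIdeal.mul_mem_left _ _ _ (relator_mem_stringIdeal i x))
  refine Submodule.span_le.mpr ?_
  rintro _ (⟨p, h⟩ | ⟨i, p, hp, h⟩ | ⟨i, p, hp, hx, c, hc, h⟩)
  · exact nonadmissibleSpan_le_stringIdeal (ofPath_mem_nonadmissibleSpan h)
  · rename_i x y
    have h1 := hrel i p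
    by_cases hx : x ∈ P i
    · rw [relator_of_mem hx, mul_sub, mul_smul_comm, ofPath_mul_e] at h1
      have h2 := nonadmissibleSpan_le_stringIdeal (P := P) (s := s)
        (ofPath_mul_sigma_mem (R := R) hsp (h hx))
      simpa using add_mem h1 h2
    · rwa [relator_of_notMem hx, mul_smul_comm, ofPath_mul_e] at h1
  · have h1 := hrel i p
    rw [relator_of_mem hx, mul_sub, mul_smul_comm, ofPath_mul_e] at h1
    have h2 := nonadmissibleSpan_le_stringIdeal (P := P) (s := s)
      (ofPath_mul_sigma_sub_mem (R := R) hsp hp hc h)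
    simpa using add_mem h1 h2

theorem ofPath_mul_relator_mem_pathRelations (hsp : IsSpecialPair Z) (i : Fin n) {x y : V}
    (p : Path x y) (hp : 0 < p.length) :
    ofPath R ⟨x, y, p⟩ * relator Z (P i) (s i) x ∈ pathRelations Z P s := by
  by_cases hx : x ∈ P i
  · rw [relator_of_mem hx, mul_sub, mul_smul_comm, ofPath_mul_e]
    by_cases h : ∃ c : Path x x, IsPrimitiveCycle Z c ∧ IsZAdmissible Z (c.comp p)
    · obtain ⟨c, hc, h⟩ := h
      have h1 : _ ∈ pathRelations Z P s := Submodule.subset_span (.sub i p hp hx c hc h)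
      have h2 := nonadmissibleSpan_le_pathRelations (P := P) (s := s)
        (ofPath_mul_sigma_sub_mem (R := R) hsp hp hc h)
      simpa using sub_mem h1 h2
    · push Not at h
      have h1 : _ ∈ pathRelations Z P s := Submodule.subset_span (.smul i p hp fun _ => h)
      exact sub_mem h1 (nonadmissibleSpan_le_pathRelations (ofPath_mul_sigma_mem (R := R) hsp h))
  · rw [relator_of_notMem hx, mul_smul_comm, ofPath_mul_e]
    exact Submodule.subset_span (.smul i p hp fun h => absurd h hx)

theorem mul_mem_relatorSpan_right (hsp : IsSpecialPair Z) (hP : IsPrimitiveNervePartition Z P)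
    (w : PathAlgebra R V) {u : PathAlgebra R V}
    (hu : u ∈ relatorSpan Z P s) : u * w ∈ relatorSpan Z P s := by
  obtain ⟨a, ha, b, hb, rfl⟩ := Submodule.mem_sup.mp hu
  rw [add_mul]
  refine add_mem (Submodule.mem_sup_left (mul_mem_nonadmissibleSpan_right w ha)) ?_
  clear hu ha
  induction hb using Submodule.span_induction with
  | zero => rw [zero_mul]; exact zero_mem _
  | add u u' _ _ hu hu' => rw [add_mul]; exact add_mem hu hu'
  | smul r u _ hu => rw [smul_mul_assoc]; exact Submodule.smul_mem _ _ hu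
  | mem u hu =>
    obtain ⟨i, x, w', rfl⟩ := hu
    rw [mul_assoc]
    apply mul_mem_relatorSpan_left
    induction w using PathAlgebra.induction_linear with
    | zero => rw [mul_zero]; exact zero_mem _
    | add w w' hw hw' => rw [mul_add]; exact add_mem hw hw'
    | smul r q =>
      obtain ⟨z, y, q⟩ := q
      rw [mul_smul_comm]
      refine Submodule.smul_mem _ _ ?_
      by_cases h : y = x
      · subst h
        -- The relator at the head of `q` is moved across `q`, becoming the relator at its tail.
        rw [← sub_add_cancel (_ * _) (ofPath R ⟨z, y, q⟩ * relator Z (P i) (s i) z)]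
        exact add_mem
          (Submodule.mem_sup_left (relator_mul_ofPath_sub_mem hsp
            (fun _ _ _ _ h => hP.mem_iff_of_comp h i) (s i) q))
          (Submodule.mem_sup_right (Submodule.subset_span ⟨i, z, _, rfl⟩))
      · rw [← relator_mul_e hsp, mul_assoc, e, QPath.triv, ofPath_mul_ofPath_of_ne _ _ h, mul_zero]
        exact zero_mem _

theorem stringIdeal_le_relatorSpan (hsp : IsSpecialPair Z)
    (hP : IsPrimitiveNervePartition Z P) {u : PathAlgebra R V} (hu : u ∈ stringIdeal Z P s) :
    u ∈ relatorSpan Z P s := by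
  let J : TwoSidedIdeal (PathAlgebra R V) := TwoSidedIdeal.mk' (relatorSpan Z P s : Set _)
    (zero_mem _) add_mem neg_mem (mul_mem_relatorSpan_left _)
    (mul_mem_relatorSpan_right hsp hP _)
  have hJ : ∀ u, u ∈ J ↔ u ∈ relatorSpan Z P s := fun u => TwoSidedIdeal.mem_mk' ..
  have hrel : ∀ i x, relator Z (P i) (s i) x ∈ J := fun i x => (hJ _).mpr
    (Submodule.mem_sup_right (Submodule.subset_span ⟨i, x, 1, (one_mul _).symm⟩))
  have hle : stringIdeal Z P s ≤ J := by
    refine sup_le (TwoSidedIdeal.span_le.mpr ?_) (iSup_le fun i =>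
      sup_le (TwoSidedIdeal.span_le.mpr ?_) (TwoSidedIdeal.span_le.mpr ?_))
    · rintro _ ⟨⟨x, y, z⟩, hz, rfl⟩
      refine (hJ _).mpr (Submodule.mem_sup_left (ofPath_mem_nonadmissibleSpan fun h => ?_))
      exact h ⟨_, hz, nil, nil, by simp⟩
    · rintro _ ⟨x, hx, rfl⟩
      rw [← relator_of_mem hx]
      exact hrel i x
    · rintro _ ⟨x, hx, rfl⟩
      rw [← relator_of_notMem (Z := Z) hx]
      exact hrel i x
  exact (hJ u).mp (hle hu)

/-- The ideal is spanned by the relations between nontrivial paths and the elements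
`relator Z (P i) (s i) x`. -/
theorem stringIdeal_le (hsp : IsSpecialPair Z) (hP : IsPrimitiveNervePartition Z P) :
    idealSubmodule (stringIdeal Z P s) ≤ pathRelations Z P s ⊔
      Submodule.span R (Set.range fun k : Fin n × V => relator Z (P k.1) (s k.1) k.2) := by
  intro u hu
  have h1 : relatorSpan Z P s ≤ pathRelations Z P s ⊔
      Submodule.span R (Set.range fun k : Fin n × V => relator Z (P k.1) (s k.1) k.2) := by
    refine sup_le (nonadmissibleSpan_le_pathRelations.trans le_sup_left)
      (Submodule.span_le.mpr ?_)
    rintro _ ⟨i, x, w, rfl⟩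
    change _ ∈ pathRelations Z P s ⊔ _
    induction w using PathAlgebra.induction_linear with
    | zero => rw [zero_mul]; exact zero_mem _
    | add w w' hw hw' => rw [add_mul]; exact add_mem hw hw'
    | smul r q =>
      obtain ⟨z, y, q⟩ := q
      rw [smul_mul_assoc]
      refine Submodule.smul_mem _ _ ?_
      by_cases h : x = z
      · subst h
        -- A trivial multiplier returns the relator itself; a nontrivial one gives an element of
        -- `pathRelations`.
        rcases Nat.eq_zero_or_pos q.length with h0 | h0
        · cases q with
          | nil =>
            have h2 := e_mul_relator hsp (P i) (s i) x
            rw [e, QPath.triv] at h2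
            rw [h2]
            exact Submodule.mem_sup_right (Submodule.subset_span ⟨(i, x), rfl⟩)
          | cons q a => simp at h0
        · exact Submodule.mem_sup_left (ofPath_mul_relator_mem_pathRelations hsp i q h0)
      · rw [← e_mul_relator hsp, ← mul_assoc, e, QPath.triv, ofPath_mul_ofPath_of_ne _ _ h,
          zero_mul]
        exact zero_mem _
  exact h1 (stringIdeal_le_relatorSpan hsp hP (mem_idealSubmodule.mp hu))

theorem coord_triv_relator (hsp : IsSpecialPair Z) (S : Set V) (r : R) (x y : V) :
    (basis R).coord (QPath.triv y) (relator Z S r x) =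
      r * (basis R).coord (QPath.triv y) (e R x) := by
  by_cases hx : x ∈ S
  · rw [relator_of_mem hx, map_sub, coord_triv_of_mem_arrowIdeal (sigma_mem_arrowIdeal hsp x),
      sub_zero, map_smul, smul_eq_mul]
  · rw [relator_of_notMem hx, map_smul, smul_eq_mul]

/-- The intersection of the ideal with `arrowIdeal R V` is spanned by the relations between
nontrivial paths. -/
theorem stringIdeal_inf_arrowIdeal_le [IsLocalRing R] [IsNoetherianRing R]
    (hZ : ∀ z ∈ Z, 2 ≤ z.length) (hsp : IsSpecialPair Z) (hP : IsPrimitiveNervePartition Z P)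
    (hreg : RingTheory.Sequence.IsRegular R (List.ofFn s)) :
    idealSubmodule (stringIdeal Z P s) ⊓ arrowIdeal R V ≤ pathRelations Z P s := by
  classical
  rintro u ⟨huI, huA⟩
  obtain ⟨k, hk, w, hw, rfl⟩ := Submodule.mem_sup.mp (stringIdeal_le hsp hP huI)
  obtain ⟨c, rfl⟩ := (Submodule.mem_span_range_iff_exists_fun R).mp hw
  refine add_mem hk ?_
  have hwA := sub_mem huA (pathRelations_le_arrowIdeal hZ hk)
  rw [add_sub_cancel_left] at hwA
  -- Elements of `arrowIdeal R V` have no trivial paths in their support, and `s i • e R x` is the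
  -- only such term in a relator at `x`.
  have hcoeff : ∀ x : V, ∑ i, c (i, x) * s i = 0 := by
    intro x
    have h1 := coord_triv_of_mem_arrowIdeal hwA x
    rw [map_sum, Fintype.sum_prod_type] at h1
    rw [← h1]
    refine Finset.sum_congr rfl fun i _ => ?_
    rw [Finset.sum_eq_single x]
    · rw [map_smul, coord_triv_relator hsp, e, coord_ofPath_self, mul_one, smul_eq_mul]
    · intro y _ hy
      rw [map_smul, coord_triv_relator hsp, e, coord_ofPath_of_ne, mul_zero, smul_zero]
      intro h
      exact hy (congrArg QPath.tail h)
    · simp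
  rw [Fintype.sum_prod_type_right]
  refine Submodule.sum_mem _ fun x _ => ?_
  have h2 : ∑ i, c (i, x) • relator Z (P i) (s i) x =
      - ∑ i, c (i, x) • (if x ∈ P i then sigma R Z x else 0) := by
    have h3 : ∑ i, (c (i, x) * s i) • e R x = 0 := by
      rw [← Finset.sum_smul, hcoeff, zero_smul]
    rw [eq_neg_iff_add_eq_zero, ← Finset.sum_add_distrib]
    refine Eq.trans (Finset.sum_congr rfl fun i _ => ?_) h3
    rw [relator, smul_sub, smul_smul, sub_add_cancel]
  rw [h2]
  refine neg_mem (Submodule.sum_mem _ fun i _ => ?_)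
  by_cases hx : x ∈ P i
  · rw [if_pos hx]
    -- By `hcoeff`, `c (i, x) * s i` is a combination of the other entries, and `s i` is regular
    -- modulo these.
    refine smul_sigma_mem_pathRelations hsp hP hx (Ideal.mem_spanOthers_of_mul_mem hreg ?_)
    have h4 := hcoeff x
    rw [← Finset.add_sum_erase _ _ (Finset.mem_univ i)] at h4
    rw [eq_neg_of_add_eq_zero_left h4]
    refine neg_mem (Ideal.sum_mem _ fun j hj => Ideal.mul_mem_left _ _ ?_)
    exact Ideal.mem_spanOthers s (Finset.ne_of_mem_erase hj)
  · rw [if_neg hx, smul_zero]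
    exact zero_mem _

end StringIdeal

/-! ### Admissible paths do not lie in the ideal -/

section NotMem

open Quiver Quiver.Path PathAlgebra

variable {R : Type w} [CommRing R] {V : Type u} [Quiver.{v} V]
  {Z : Set (QPath V)} {n : ℕ} {P : Fin n → Set V} {s : Fin n → R}

/-- Only a non-admissible path or the longer term of a binomial occurs in a relation with a unit
coefficient, and `p` is neither; so all relations have coefficient at `p` in the maximal ideal. -/
theorem ofPath_notMem_pathRelations_of_not_primitive [IsLocalRing R]
    (hs : ∀ i, s i ∈ IsLocalRing.maximalIdeal R)
    {x y : V} {p : Path x y} (hadm : IsZAdmissible Z p)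
    (h : ∀ (c : Path x x) (q : Path x y), IsPrimitiveCycle Z c → 0 < q.length → p ≠ c.comp q) :
    ofPath R ⟨x, y, p⟩ ∉ pathRelations Z P s := by
  intro hp
  have hle : pathRelations Z P s ≤
      ((IsLocalRing.maximalIdeal R).restrictScalars R).comap ((basis R).coord ⟨x, y, p⟩) := by
    refine Submodule.span_le.mpr ?_
    rintro _ (⟨q, hq⟩ | ⟨i, q, hq, -⟩ | ⟨i, q, hq, -, c, hc, -⟩)
    · change (basis R).coord _ _ ∈ IsLocalRing.maximalIdeal R
      rw [coord_ofPath_of_ne]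
      · exact zero_mem _
      · intro heq
        cases heq
        exact hq hadm
    · change (basis R).coord _ _ ∈ IsLocalRing.maximalIdeal R
      rw [map_smul]
      exact Ideal.mul_mem_right _ _ (hs i)
    · change (basis R).coord _ _ ∈ IsLocalRing.maximalIdeal R
      rw [map_sub, map_smul, coord_ofPath_of_ne (q := ⟨_, _, c.comp q⟩), sub_zero]
      · exact Ideal.mul_mem_right _ _ (hs i)
      · intro heq
        cases heq
        exact h c q hc hq rfl
  have h1 : (basis R).coord ⟨x, y, p⟩ (ofPath R ⟨x, y, p⟩) ∈ IsLocalRing.maximalIdeal R := hle hp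
  rw [coord_ofPath_self] at h1
  exact (IsLocalRing.maximalIdeal.isMaximal R).ne_top ((Ideal.eq_top_iff_one _).mpr h1)

open Classical in
/-- The functional that sends a path `q` with the same first arrow as `c`, and of length congruent
to `m` modulo the length of `c`, to `t ^ k` where `k` is the number of times `q` runs through
`c`. -/
noncomputable def windingFunctional (Z : Set (QPath V)) {x : V} (c : Path x x) (m : ℕ)
    {M : Type w} [CommRing M] [Algebra R M] (t : M) : PathAlgebra R V →ₗ[R] M :=
  (basis R).constr R fun q =>
    if IsZAdmissible Z q.path ∧ q.path.arrows.head? = c.arrows.head? ∧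
      q.length % c.length = m % c.length then t ^ (q.length / c.length) else 0

open Classical in
theorem windingFunctional_ofPath {x : V} (c : Path x x) (m : ℕ) {M : Type w} [CommRing M]
    [Algebra R M] (t : M) {y z : V} (q : Path y z) :
    windingFunctional (R := R) Z c m t (ofPath R ⟨y, z, q⟩) =
      if IsZAdmissible Z q ∧ q.arrows.head? = c.arrows.head? ∧
        q.length % c.length = m % c.length then t ^ (q.length / c.length) else 0 := by
  rw [windingFunctional, ofPath, Module.Basis.constr_basis]
  rfl

/-- On paths starting like `c`, one more turn multiplies the value by `s i`, which matches the
binomials with index `i`; scalars `s j` with `j ≠ i` act as zero on the quotient, and paths starting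
differently have value zero. -/
theorem pathRelations_le_ker_windingFunctional (hsp : IsSpecialPair Z)
    (hP : IsPrimitiveNervePartition Z P) {i : Fin n} {x : V} (hx : x ∈ P i) {c : Path x x}
    (hc : IsPrimitiveCycle Z c) (m : ℕ) :
    pathRelations Z P s ≤ LinearMap.ker (windingFunctional (R := R) Z c m
      (Ideal.Quotient.mk (Ideal.spanOthers s i) (s i))) := by
  have hj : ∀ j, j ≠ i → ∀ u : R ⧸ Ideal.spanOthers s i, s j • u = 0 := by
    intro j hj u
    rw [Algebra.smul_def, Ideal.Quotient.algebraMap_eq,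
      Ideal.Quotient.eq_zero_iff_mem.mpr (Ideal.mem_spanOthers s hj), zero_mul]
  have htail : ∀ {y z : V} {q : Path y z}, q.arrows.head? = c.arrows.head? → y = x := by
    intro y z q hq
    obtain ⟨b, hb⟩ := c.exists_head?_arrows hc.nontrivial
    exact (fst_of_head?_arrows (hq.trans hb)).symm.trans (fst_of_head?_arrows hb)
  refine Submodule.span_le.mpr ?_
  rintro _ (⟨q, hq⟩ | ⟨j, q, hq, h⟩ | ⟨j, q, hq, hy, d, hd, h⟩)
  · change windingFunctional Z c m _ _ = 0
    rw [windingFunctional_ofPath, if_neg fun h => hq h.1]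
  · change windingFunctional Z c m _ _ = 0
    rw [map_smul, windingFunctional_ofPath]
    split_ifs with hcond
    · obtain rfl := htail hcond.2.1
      refine hj j ?_ _
      rintro rfl
      -- For `j = i` the monomial relation is excluded, since a path starting like `c` can be
      -- preceded by `c`.
      exact h hx c hc (hc.comp_isZAdmissible hsp hq hcond.1 hcond.2.1.symm)
    · rw [smul_zero]
  · change windingFunctional Z c m _ _ = 0
    rw [map_sub, map_smul, windingFunctional_ofPath, windingFunctional_ofPath]
    have hdq := hd.head?_eq hsp hq h
    rw [head?_arrows_comp _ hd.nontrivial]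
    by_cases hcq : q.arrows.head? = c.arrows.head?
    · obtain rfl := htail hcq
      obtain rfl := hd.eq hsp hc (hdq.trans hcq)
      obtain rfl := hP.eq_of_mem hx hy
      simp only [h, h.of_comp_right, hcq, true_and, length_comp, Nat.add_mod_left,
        Nat.add_div_left _ hd.nontrivial]
      split_ifs
      · rw [Algebra.smul_def, Ideal.Quotient.algebraMap_eq, pow_succ', sub_self]
      · rw [smul_zero, sub_zero]
    · rw [if_neg fun h => hcq h.2.1, if_neg fun h => hcq (hdq.symm.trans h.2.1), smul_zero,
        sub_zero]

theorem ofPath_notMem_pathRelations [IsLocalRing R] [IsNoetherianRing R] (hsp : IsSpecialPair Z)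
    (hP : IsPrimitiveNervePartition Z P) (hs : ∀ i, s i ∈ IsLocalRing.maximalIdeal R)
    (hreg : RingTheory.Sequence.IsRegular R (List.ofFn s))
    {x y : V} {p : Path x y} (hadm : IsZAdmissible Z p) :
    ofPath R ⟨x, y, p⟩ ∉ pathRelations Z P s := by
  by_cases h : ∃ (c : Path x x) (q : Path x y), IsPrimitiveCycle Z c ∧ 0 < q.length ∧
      p = c.comp q
  · obtain ⟨c, q, hc, hq, rfl⟩ := h
    obtain ⟨i, hi⟩ := hP.exists_mem hc
    intro hp
    have h1 := pathRelations_le_ker_windingFunctional hsp hP hi hc (c.comp q).length hp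
    rw [LinearMap.mem_ker, windingFunctional_ofPath,
      if_pos ⟨hadm, head?_arrows_comp _ hc.nontrivial, rfl⟩, ← map_pow,
      Ideal.Quotient.eq_zero_iff_mem] at h1
    exact Ideal.pow_notMem_spanOthers hreg hs i _ h1
  · exact ofPath_notMem_pathRelations_of_not_primitive hs hadm
      fun c q hc hq heq => h ⟨c, q, hc, hq, heq⟩

variable [Fintype V] [Finite (TotalArrow V)]

theorem stringIdeal_le_arrowIdeal_sup_coeffIdeal [IsLocalRing R]
    (hZ : ∀ z ∈ Z, 2 ≤ z.length) (hsp : IsSpecialPair Z) (hP : IsPrimitiveNervePartition Z P)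
    (hs : ∀ i, s i ∈ IsLocalRing.maximalIdeal R) :
    idealSubmodule (stringIdeal Z P s) ≤
      arrowIdeal R V ⊔ coeffIdeal (IsLocalRing.maximalIdeal R) V := by
  refine (stringIdeal_le hsp hP).trans (sup_le
    ((pathRelations_le_arrowIdeal hZ).trans le_sup_left) (Submodule.span_le.mpr ?_))
  rintro _ ⟨⟨i, x⟩, rfl⟩
  have h1 : s i • e R x ∈ arrowIdeal R V ⊔ coeffIdeal (IsLocalRing.maximalIdeal R) V :=
    Submodule.mem_sup_right (smul_mem_coeffIdeal (hs i) _)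
  change relator Z (P i) (s i) x ∈ arrowIdeal R V ⊔ coeffIdeal (IsLocalRing.maximalIdeal R) V
  by_cases hx : x ∈ P i
  · rw [relator_of_mem hx]
    exact sub_mem h1 (Submodule.mem_sup_left (sigma_mem_arrowIdeal hsp x))
  · rwa [relator_of_notMem hx]

theorem ofPath_notMem_stringIdeal [IsLocalRing R] [IsNoetherianRing R]
    (hZ : ∀ z ∈ Z, 2 ≤ z.length) (hsp : IsSpecialPair Z) (hP : IsPrimitiveNervePartition Z P)
    (hs : ∀ i, s i ∈ IsLocalRing.maximalIdeal R)
    (hreg : RingTheory.Sequence.IsRegular R (List.ofFn s)) {p : QPath V}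
    (hadm : IsZAdmissible Z p.path) : ofPath R p ∉ stringIdeal Z P s := by
  intro hp
  obtain ⟨x, y, p⟩ := p
  rcases Nat.eq_zero_or_pos p.length with h0 | h0
  · cases p with
    | nil =>
      -- For a trivial path the obstruction is its own coefficient: elements of the ideal have
      -- coefficients in the maximal ideal at trivial paths.
      obtain ⟨a, ha, b, hb, hab⟩ := Submodule.mem_sup.mp
        (stringIdeal_le_arrowIdeal_sup_coeffIdeal hZ hsp hP hs (mem_idealSubmodule.mpr hp))
      have h1 := congrArg ((basis R).coord (QPath.triv x)) hab
      rw [map_add, coord_triv_of_mem_arrowIdeal ha, zero_add] at h1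
      have h2 := coord_mem_of_mem_coeffIdeal hb (QPath.triv x)
      rw [h1, show (⟨x, x, nil⟩ : QPath V) = QPath.triv x from rfl, coord_ofPath_self] at h2
      exact (IsLocalRing.maximalIdeal.isMaximal R).ne_top ((Ideal.eq_top_iff_one _).mpr h2)
    | cons p a => simp at h0
  · exact ofPath_notMem_pathRelations hsp hP hs hreg hadm (stringIdeal_inf_arrowIdeal_le hZ hsp hP
      hreg ⟨mem_idealSubmodule.mpr hp, ofPath_mem_arrowIdeal h0⟩)

end NotMem

/-! ### The string algebra -/

section StringAlgebra

open Quiver Quiver.Path PathAlgebra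

variable {R : Type w} [CommRing R] {V : Type u} [Quiver.{v} V] [Fintype V]
  {Z : Set (QPath V)} {n : ℕ} {P : Fin n → Set V} {s : Fin n → R}

theorem mul_arrow_mem {X : Submodule R (PathAlgebra R V)} {x y : V} (a : x ⟶ y)
    (hX : ∀ (z : V) (p : Path y z), ofPath R ⟨x, z, a.toPath.comp p⟩ ∈ X) (w : PathAlgebra R V) :
    w * arrow R a ∈ X := by
  induction w using PathAlgebra.induction_linear with
  | zero => rw [zero_mul]; exact zero_mem _
  | add w w' hw hw' => rw [add_mul]; exact add_mem hw hw'
  | smul r p =>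
    obtain ⟨t, z, p⟩ := p
    rw [smul_mul_assoc, arrow, QPath.ofArrow]
    refine Submodule.smul_mem _ _ ?_
    by_cases h : y = t
    · subst h
      rw [ofPath_mul_ofPath]
      exact hX z p
    · rw [ofPath_mul_ofPath_of_ne _ _ h]
      exact zero_mem _

theorem arrow_mul_mem {X : Submodule R (PathAlgebra R V)} {x y : V} (a : x ⟶ y)
    (hX : ∀ (z : V) (p : Path z x), ofPath R ⟨z, y, p.comp a.toPath⟩ ∈ X) (w : PathAlgebra R V) :
    arrow R a * w ∈ X := by
  induction w using PathAlgebra.induction_linear with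
  | zero => rw [mul_zero]; exact zero_mem _
  | add w w' hw hw' => rw [mul_add]; exact add_mem hw hw'
  | smul r p =>
    obtain ⟨z, t, p⟩ := p
    rw [mul_smul_comm, arrow, QPath.ofArrow]
    refine Submodule.smul_mem _ _ ?_
    by_cases h : t = x
    · subst h
      rw [ofPath_mul_ofPath]
      exact hX z p
    · rw [ofPath_mul_ofPath_of_ne _ _ h]
      exact zero_mem _

theorem mul_arrow_mem_arrowIdeal {x y : V} (a : x ⟶ y) (w : PathAlgebra R V) :
    w * arrow R a ∈ arrowIdeal R V :=
  mul_arrow_mem a (fun z p => ofPath_mem_arrowIdeal (by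
    simp only [QPath.length, length_comp, length_toPath]
    omega)) w

theorem arrow_mul_mem_arrowIdeal {x y : V} (a : x ⟶ y) (w : PathAlgebra R V) :
    arrow R a * w ∈ arrowIdeal R V :=
  arrow_mul_mem a (fun z p => ofPath_mem_arrowIdeal (by
    simp [QPath.length])) w

theorem mk'_eq_zero_iff {I : TwoSidedIdeal (PathAlgebra R V)} {u : PathAlgebra R V} :
    I.ringCon.mk' u = 0 ↔ u ∈ I := by
  rw [← TwoSidedIdeal.mem_ker, TwoSidedIdeal.ker_ringCon_mk']

theorem isSpecialIdeal_stringIdeal (hsp : IsSpecialPair Z) :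
    IsSpecialIdeal (stringIdeal Z P s) := by
  have h : ∀ {x y z : V} (a : y ⟶ z) (b : x ⟶ y), arrow R a * arrow R b ∉ stringIdeal Z P s →
      QPath.ofArrows a b ∉ Z := by
    intro x y z a b hab hZ
    refine hab ?_
    rw [arrow, arrow, QPath.ofArrow, QPath.ofArrow, ofPath_mul_ofPath]
    exact ofPath_mem_stringIdeal_of_mem hZ
  exact ⟨fun x y b => (hsp.1 x y b).anti fun a ha => h _ _ ha,
    fun x y b => (hsp.2 x y b).anti fun c hc => h _ _ hc⟩

variable [Finite (TotalArrow V)]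

theorem smul_ofPath_sub_mem_stringIdeal (hsp : IsSpecialPair Z) {i : Fin n} {x y : V}
    (hi : x ∈ P i) {c : Path x x} (hc : IsPrimitiveCycle Z c) {q : Path x y} (hq : 0 < q.length)
    (h : IsZAdmissible Z (c.comp q)) :
    s i • ofPath R ⟨x, y, q⟩ - ofPath R ⟨x, y, c.comp q⟩ ∈ idealSubmodule (stringIdeal Z P s) :=
  pathRelations_le_stringIdeal hsp (Submodule.subset_span (.sub i q hq hi c hc h))

theorem exists_arrowIdeal_pow_le [IsLocalRing R] (hsp : IsSpecialPair Z)
    (hP : IsPrimitiveNervePartition Z P) (hs : ∀ i, s i ∈ IsLocalRing.maximalIdeal R) :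
    ∃ m : ℕ, 0 < m ∧ arrowIdeal R V ^ m ≤
      idealSubmodule (stringIdeal Z P s) ⊔ coeffIdeal (IsLocalRing.maximalIdeal R) V := by
  obtain ⟨h, hh⟩ := exists_bound_eq_comp hsp
  refine ⟨h + 1, h.succ_pos, (arrowIdeal_pow_le _).trans (Submodule.span_le.mpr ?_)⟩
  rintro _ ⟨⟨x, y, p⟩, hp, rfl⟩
  by_cases hadm : IsZAdmissible Z p
  · obtain ⟨c, q, hc, hq, rfl⟩ := hh x y p hadm hp
    obtain ⟨i, hi⟩ := hP.exists_mem hc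
    have h1 := smul_ofPath_sub_mem_stringIdeal (R := R) (s := s) hsp hi hc hq hadm
    have h2 := smul_mem_coeffIdeal (hs i) (ofPath R ⟨x, y, q⟩)
    simpa using sub_mem (Submodule.mem_sup_right h2) (Submodule.mem_sup_left h1)
  · exact Submodule.mem_sup_left
      (nonadmissibleSpan_le_stringIdeal (ofPath_mem_nonadmissibleSpan hadm))

theorem exists_coeffIdeal_le [IsLocalRing R] (hsp : IsSpecialPair Z)
    (hP : IsPrimitiveNervePartition Z P)
    (hgen : Ideal.span (Set.range s) = IsLocalRing.maximalIdeal R) :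
    ∃ h : ℕ, 0 < h ∧ coeffIdeal (IsLocalRing.maximalIdeal R) V ≤
      idealSubmodule (stringIdeal Z P s) ⊔ ⨆ l ∈ Set.Icc 1 h, lengthSpan R V l := by
  obtain ⟨h, hh⟩ := exists_bound_eq_comp hsp
  refine ⟨h + 1, h.succ_pos, ?_⟩
  set X := idealSubmodule (stringIdeal Z P s) ⊔ ⨆ l ∈ Set.Icc 1 (h + 1), lengthSpan R V l with hX
  -- A path `c.comp q` too long for the span is congruent to `s i` times the shorter path `q`, so
  -- induction on the length applies.
  have hpath : ∀ (m : ℕ) (x y : V) (p : Path x y), p.length = m → 0 < m →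
      ofPath R ⟨x, y, p⟩ ∈ X := by
    intro m
    induction m using Nat.strong_induction_on with
    | _ m ih =>
    intro x y p hpm hm
    by_cases hadm : IsZAdmissible Z p
    · by_cases hl : p.length ≤ h + 1
      · refine Submodule.mem_sup_right (Submodule.mem_iSup_of_mem m (Submodule.mem_iSup_of_mem
          (p := fun _ => lengthSpan R V _) ⟨hm, hpm ▸ hl⟩
          (Submodule.subset_span ⟨⟨x, y, p⟩, hpm, rfl⟩)))
      · obtain ⟨c, q, hc, hq, rfl⟩ := hh x y p hadm (by omega)
        obtain ⟨i, hi⟩ := hP.exists_mem hc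
        have h1 := smul_ofPath_sub_mem_stringIdeal (R := R) (s := s) hsp hi hc hq hadm
        have hlt : q.length < m := by
          have := hc.nontrivial
          rw [length_comp] at hpm
          omega
        have h2 := X.smul_mem (s i) (ih q.length hlt x y q rfl hq)
        simpa using sub_mem h2 (Submodule.mem_sup_left h1)
    · exact Submodule.mem_sup_left
        (nonadmissibleSpan_le_stringIdeal (ofPath_mem_nonadmissibleSpan hadm))
  have hA : arrowIdeal R V ≤ X := arrowIdeal_le fun p hp => hpath _ _ _ p.path rfl hp
  have htriv : ∀ (x : V) (r : R), r ∈ IsLocalRing.maximalIdeal R → r • e R x ∈ X := by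
    intro x r hr
    rw [← hgen] at hr
    induction hr using Submodule.span_induction with
    | zero => rw [zero_smul]; exact zero_mem _
    | add r r' _ _ hr hr' => rw [add_smul]; exact add_mem hr hr'
    | smul t r _ hr => rw [smul_eq_mul, mul_smul]; exact Submodule.smul_mem _ _ hr
    | mem r hr =>
      obtain ⟨i, rfl⟩ := hr
      have h1 : relator Z (P i) (s i) x ∈ X :=
        Submodule.mem_sup_left (mem_idealSubmodule.mpr (relator_mem_stringIdeal i x))
      by_cases hx : x ∈ P i
      · rw [relator_of_mem hx] at h1
        simpa using add_mem h1 (hA (sigma_mem_arrowIdeal hsp x))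
      · rwa [relator_of_notMem hx] at h1
  intro u hu
  rw [← (basis R).linearCombination_repr u, Finsupp.linearCombination_apply, Finsupp.sum]
  refine Submodule.sum_mem _ fun p _ => ?_
  have hp := hu p
  obtain ⟨x, y, p⟩ := p
  rcases Nat.eq_zero_or_pos p.length with h0 | h0
  · cases p with
    | nil => exact htriv x _ hp
    | cons p a => simp at h0
  · exact Submodule.smul_mem _ _ (hpath _ x y p rfl h0)

theorem isAdmissibleIdeal_stringIdeal [IsLocalRing R] [IsNoetherianRing R]
    (hZ : ∀ z ∈ Z, 2 ≤ z.length) (hsp : IsSpecialPair Z) (hP : IsPrimitiveNervePartition Z P)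
    (hreg : RingTheory.Sequence.IsRegular R (List.ofFn s))
    (hgen : Ideal.span (Set.range s) = IsLocalRing.maximalIdeal R) :
    IsAdmissibleIdeal (stringIdeal Z P s) := by
  have hs : ∀ i, s i ∈ IsLocalRing.maximalIdeal R :=
    fun i => hgen ▸ Ideal.subset_span (Set.mem_range_self i)
  refine ⟨stringIdeal_le_arrowIdeal_sup_coeffIdeal hZ hsp hP hs, ?_,
    exists_arrowIdeal_pow_le hsp hP hs, exists_coeffIdeal_le hsp hP hgen⟩
  refine (stringIdeal_inf_arrowIdeal_le hZ hsp hP hreg).trans (Submodule.span_le.mpr ?_)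
  have hsmul : ∀ (i : Fin n) {x y : V} (p : Path x y), 0 < p.length →
      s i • ofPath R ⟨x, y, p⟩ ∈
        arrowIdeal R V ^ 2 ⊔ coeffIdeal (IsLocalRing.maximalIdeal R) V ⊓ arrowIdeal R V :=
    fun i x y p hp => Submodule.mem_sup_right ⟨smul_mem_coeffIdeal (hs i) _,
      Submodule.smul_mem _ _ (ofPath_mem_arrowIdeal hp)⟩
  rintro _ (⟨p, h⟩ | ⟨i, p, hp, -⟩ | ⟨i, p, hp, -, c, hc, -⟩)
  · exact Submodule.mem_sup_left
      (ofPath_mem_arrowIdeal_sq (two_le_length_of_not_isZAdmissible hZ h))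
  · exact hsmul i p hp
  · refine sub_mem (hsmul i p hp) (Submodule.mem_sup_left (ofPath_mem_arrowIdeal_sq ?_))
    have := hc.nontrivial
    rw [length_comp]
    omega

/-- If `u` and `u'` are combinations of nontrivial paths that satisfy, respectively do not satisfy,
a predicate that is invariant under composition with primitive cycles, and `u ≡ u'` modulo the
ideal, then `u` lies in the ideal. -/
theorem mem_stringIdeal_of_sub_mem [IsLocalRing R] [IsNoetherianRing R]
    (hZ : ∀ z ∈ Z, 2 ≤ z.length) (hsp : IsSpecialPair Z) (hP : IsPrimitiveNervePartition Z P)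
    (hreg : RingTheory.Sequence.IsRegular R (List.ofFn s)) {S : QPath V → Prop}
    (hS : ∀ (x y : V) (p : Path x y) (c : Path x x), 0 < p.length → IsPrimitiveCycle Z c →
      IsZAdmissible Z (c.comp p) → (S ⟨x, y, c.comp p⟩ ↔ S ⟨x, y, p⟩))
    {u u' : PathAlgebra R V} (hu : u ∈ arrowIdeal R V) (hu' : u' ∈ arrowIdeal R V)
    (hSu : proj R S u = u) (hSu' : proj R S u' = 0) (h : u - u' ∈ stringIdeal Z P s) :
    u ∈ stringIdeal Z P s := by
  have h1 := proj_mem_pathRelations hS (stringIdeal_inf_arrowIdeal_le hZ hsp hP hreg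
    ⟨mem_idealSubmodule.mpr h, sub_mem hu hu'⟩)
  rw [map_sub, hSu, hSu', sub_zero] at h1
  exact mem_idealSubmodule.mp (pathRelations_le_stringIdeal hsp h1)

theorem isArrowDirect_stringIdeal [IsLocalRing R] [IsNoetherianRing R]
    (hZ : ∀ z ∈ Z, 2 ≤ z.length) (hsp : IsSpecialPair Z) (hP : IsPrimitiveNervePartition Z P)
    (hreg : RingTheory.Sequence.IsRegular R (List.ofFn s)) :
    IsArrowDirect (stringIdeal Z P s) := by
  intro x y a
  set I := stringIdeal Z P s with hI
  constructor
  · let S : QPath V → Prop := fun p => p.path.arrows.head? = some ⟨x, y, a⟩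
    have hS : ∀ (x y : V) (p : Path x y) (c : Path x x), 0 < p.length → IsPrimitiveCycle Z c →
        IsZAdmissible Z (c.comp p) → (S ⟨x, y, c.comp p⟩ ↔ S ⟨x, y, p⟩) := by
      intro x y p c hp hc h
      simp only [S]
      rw [head?_arrows_comp _ hc.nontrivial, hc.head?_eq hsp hp h]
    rw [eq_bot_iff]
    rintro t ⟨ht, ht'⟩
    obtain ⟨w, rfl⟩ := Submodule.mem_span_singleton.mp ht
    obtain ⟨w, rfl⟩ := I.ringCon.mk'_surjective w
    rw [SetLike.mem_coe, iSup_subtype'] at ht'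
    -- The sum over the other arrows is lifted to the path algebra as a combination of paths whose
    -- first arrow is not `a`, which the projection kills.
    obtain ⟨u', hu', hSu', heq⟩ : ∃ u' ∈ arrowIdeal R V, proj R S u' = 0 ∧
        I.ringCon.mk' u' = I.ringCon.mk' w • quotArrow I a := by
      refine Submodule.iSup_induction _ (motive := fun t => ∃ u' ∈ arrowIdeal R V,
        proj R S u' = 0 ∧ I.ringCon.mk' u' = t) ht' ?_ ?_ ?_
      · rintro ⟨⟨z, b⟩, hb⟩ t ht
        obtain ⟨v, rfl⟩ := Submodule.mem_span_singleton.mp ht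
        obtain ⟨v, rfl⟩ := I.ringCon.mk'_surjective v
        refine ⟨v * arrow R b, mul_arrow_mem_arrowIdeal b v, ?_, map_mul _ _ _⟩
        refine LinearMap.mem_ker.mp (mul_arrow_mem b (fun z' p => ?_) v)
        refine proj_ofPath_of_neg fun h => hb ?_
        simp only [S, arrows_comp, arrows_toPath, List.singleton_append, List.head?_cons,
          Option.some.injEq] at h
        cases h
        rfl
      · exact ⟨0, zero_mem _, map_zero _, map_zero _⟩
      · rintro t t' ⟨u, hu, hu0, rfl⟩ ⟨u', hu', hu0', rfl⟩
        exact ⟨u + u', add_mem hu hu', by rw [map_add, hu0, hu0', add_zero], map_add _ _ _⟩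
    rw [smul_eq_mul, quotArrow, ← map_mul] at heq ⊢
    rw [Submodule.mem_bot, mk'_eq_zero_iff]
    refine mem_stringIdeal_of_sub_mem hZ hsp hP hreg hS (mul_arrow_mem_arrowIdeal a w) hu' ?_ hSu'
      ?_
    · refine mul_arrow_mem (X := LinearMap.eqLocus (proj R S) LinearMap.id) a (fun z p => ?_) w
      exact proj_ofPath_of_pos (by simp [S])
    · rw [← hI, ← mk'_eq_zero_iff, map_sub, heq, sub_self]
  · let S : QPath V → Prop := fun p => p.path.arrows.getLast? = some ⟨x, y, a⟩
    have hS : ∀ (x y : V) (p : Path x y) (c : Path x x), 0 < p.length → IsPrimitiveCycle Z c →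
        IsZAdmissible Z (c.comp p) → (S ⟨x, y, c.comp p⟩ ↔ S ⟨x, y, p⟩) := by
      intro x y p c hp hc h
      simp only [S]
      -- Prefixing a cycle to a nontrivial path leaves its last arrow alone.
      rw [getLast?_arrows_comp _ hp]
    rw [eq_bot_iff]
    rintro t ⟨ht, ht'⟩
    obtain ⟨⟨w⟩, rfl⟩ := Submodule.mem_span_singleton.mp ht
    obtain ⟨w, rfl⟩ := I.ringCon.mk'_surjective w
    rw [SetLike.mem_coe, iSup_subtype'] at ht'
    obtain ⟨u', hu', hSu', heq⟩ : ∃ u' ∈ arrowIdeal R V, proj R S u' = 0 ∧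
        I.ringCon.mk' u' = MulOpposite.op (I.ringCon.mk' w) • quotArrow I a := by
      refine Submodule.iSup_induction _ (motive := fun t => ∃ u' ∈ arrowIdeal R V,
        proj R S u' = 0 ∧ I.ringCon.mk' u' = t) ht' ?_ ?_ ?_
      · rintro ⟨⟨z, b⟩, hb⟩ t ht
        obtain ⟨⟨v⟩, rfl⟩ := Submodule.mem_span_singleton.mp ht
        obtain ⟨v, rfl⟩ := I.ringCon.mk'_surjective v
        refine ⟨arrow R b * v, arrow_mul_mem_arrowIdeal b v, ?_, map_mul _ _ _⟩
        refine LinearMap.mem_ker.mp (arrow_mul_mem b (fun z' p => ?_) v)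
        refine proj_ofPath_of_neg fun h => hb ?_
        simp only [S, arrows_comp, arrows_toPath, List.getLast?_append, List.getLast?_singleton,
          Option.some_or, Option.some.injEq] at h
        cases h
        rfl
      · exact ⟨0, zero_mem _, map_zero _, map_zero _⟩
      · rintro t t' ⟨u, hu, hu0, rfl⟩ ⟨u', hu', hu0', rfl⟩
        exact ⟨u + u', add_mem hu hu', by rw [map_add, hu0, hu0', add_zero], map_add _ _ _⟩
    -- The opposite ring acts by multiplication on the right.
    change I.ringCon.mk' u' = quotArrow I a * I.ringCon.mk' w at heq
    change quotArrow I a * I.ringCon.mk' w ∈ _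
    rw [quotArrow, ← map_mul] at heq ⊢
    rw [Submodule.mem_bot, mk'_eq_zero_iff]
    refine mem_stringIdeal_of_sub_mem hZ hsp hP hreg hS (arrow_mul_mem_arrowIdeal a w) hu' ?_ hSu'
      ?_
    · refine arrow_mul_mem (X := LinearMap.eqLocus (proj R S) LinearMap.id) a (fun z p => ?_) w
      exact proj_ofPath_of_pos (by simp [S])
    · rw [← hI, ← mk'_eq_zero_iff, map_sub, heq, sub_self]

end StringAlgebra

theorem theorem1p1 {V : Type u} [Quiver.{v} V] [Fintype V] [∀ x y : V, Finite (x ⟶ y)]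
    (Z : Set (QPath V)) (hZ : ∀ z ∈ Z, 2 ≤ z.length) (hsp : IsSpecialPair Z)
    {n : ℕ} (P : Fin n → Set V) (hP : IsPrimitiveNervePartition Z P)
    {R : Type w} [CommRing R] [IsRegularLocalRing R] (hdim : ringKrullDim R = n)
    (s : Fin n → R) (hreg : RingTheory.Sequence.IsRegular R (List.ofFn s))
    (hgen : Ideal.span (Set.range s) = IsLocalRing.maximalIdeal R) :
    (∀ x : V, {c : Quiver.Path x x | IsPrimitiveCycle Z c}.Finite) ∧
    (∀ p : QPath V, IsZAdmissible Z p.path →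
      PathAlgebra.ofPath R p ∉ stringIdeal Z P s) ∧
    (IsBiserial V → IsStringAlgebra (stringIdeal Z P s)) := by
  have hs : ∀ i, s i ∈ IsLocalRing.maximalIdeal R :=
    fun i => hgen ▸ Ideal.subset_span (Set.mem_range_self i)
  exact ⟨finite_setOf_isPrimitiveCycle hsp,
    fun p hp => ofPath_notMem_stringIdeal hZ hsp hP hs hreg hp,
    fun hbi => ⟨hbi, isAdmissibleIdeal_stringIdeal hZ hsp hP hreg hgen,
      isSpecialIdeal_stringIdeal hsp, isArrowDirect_stringIdeal hZ hsp hP hreg⟩⟩
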